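/- Let $G=(V,E)$ be a finite, connected, simple, undirected graph with a (not necessarily proper) node coloring $col:V\to C$. For a set $W\subseteq V$ and a color $c\in C$ let $\Gamma(W,c)$ be the set of all nodes of color $c$ that can be reached from some $w\in W$ by a path with at least one edge on which all nodes after $w$ have color $c$. A color sequence $\gamma_1,\dots,\gamma_b$ started on $W_1=\{v_0\}$ yields the sets $W_{i+1}=W_i\cup\Gamma(W_i,\gamma_i)$ for $1\le i\le b$, and it conquers $W_{b+1}$. Honey-Bee-Solitaire is the following decision problem: given $G$, $C$, $col$, a start node $v_0\in V$ and a bound $b\in\mathbb{N}$ (in binary), is there a color sequence of length $b$ that conquers $V$ when started on $\{v_0\}$? A co-comparability graph is a graph whose nodes carry a partial order such that two distinct nodes are adjacent if and only if they are incomparable. Theorem. Honey-Bee-Solitaire can be solved in polynomial time on co-comparability graphs, for an arbitrary start node. That is, there are a deterministic algorithm (on a uniform-cost random access machine whose arithmetic consists of addition and truncated subtraction, a model polynomially equivalent to Turing machines) and a polynomial $p$ such that for every instance in which $G$ is a connected co-comparability graph, given by its adjacency matrix only (without a partial order), the algorithm halts after at most $p(s)$ steps with the correct answer, where $s$ is the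 bit length of the instance. -/

import Mathlib

noncomputable section

namespace HoneyBee

/-! ### The game -/

/-- The color-`c`-neighborhood of a node `v`: all nodes `u` that can be reached from `v` by a
nonempty sequence of edges, each of which leads into a node of color `c`. These are the nodes of
color `c` that are adjacent to `v`, or connected to `v` by a path of nodes of color `c`. -/
def nodeNbhd {V C : Type*} (G : SimpleGraph V) (col : V → C) (v : V) (c : C) : Set V :=
  {u | Relation.TransGen (fun x y => G.Adj x y ∧ col y = c) v u}

/-- The color-`c`-neighborhood of a set `W` of nodes. -/
def setNbhd {V C : Type*} (G : SimpleGraph V) (col : V → C) (W : Set V) (c : C) : Set V :=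
  ⋃ w ∈ W, nodeNbhd G col w c

/-- The node set conquered by the color sequence `γ` started on `W`: the colors are called one
after the other, and calling `c` replaces the territory `W` by its union with the
color-`c`-neighborhood of `W`. -/
def conquered {V C : Type*} (G : SimpleGraph V) (col : V → C) (W : Set V) (γ : List C) : Set V :=
  γ.foldl (fun W c => W ∪ setNbhd G col W c) W

/-- A co-comparability graph: its nodes carry a partial order such that two different nodes are
adjacent exactly if they are incomparable. -/
def IsCocomparability {V : Type*} (G : SimpleGraph V) : Prop :=
  ∃ P : PartialOrder V, ∀ u v : V, G.Adj u v ↔ u ≠ v ∧ ¬ P.lt u v ∧ ¬ P.lt v u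

/-- An instance of Honey-Bee-Solitaire: a graph on the nodes `0, …, n - 1`, a (not necessarily
proper) coloring with the colors `0, …, k - 1`, a start node and a bound. -/
structure Instance where
  n : ℕ
  k : ℕ
  graph : SimpleGraph (Fin n)
  col : Fin n → Fin k
  start : Fin n
  bound : ℕ

/-- The answer is YES: some color sequence of length `bound` conquers all nodes when it is started
on the start node. -/
def Instance.IsYes (I : Instance) : Prop :=
  ∃ γ : List (Fin I.k), γ.length = I.bound ∧
    conquered I.graph I.col {I.start} γ = Set.univ

/-- The number of bits of the instance: the adjacency matrix (`n * n` bits), the color of each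
node, and the numbers `n`, `k`, the start node and the bound in binary. -/
def Instance.size (I : Instance) : ℕ :=
  I.n * I.n + I.n * Nat.size I.k + Nat.size I.n + Nat.size I.k + Nat.size I.n + Nat.size I.bound

/-! ### Random access machines

Deterministic structured programs over natural numbers, with scalar variables and
two-dimensional arrays. Arithmetic consists of addition and truncated subtraction only (no
multiplication), so that `t` steps can lengthen a number by at most `t` bits. Hence the uniform
cost measure below is polynomially related to the running time of Turing machines. -/

/-- The memory: the values of the scalar variables `0, 1, 2, …` and the entries of the
two-dimensional arrays `0, 1, 2, …`. -/
structure Memory where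
  var : ℕ → ℕ
  arr : ℕ → ℕ → ℕ → ℕ

/-- Writing a scalar variable. -/
def Memory.setVar (m : Memory) (x a : ℕ) : Memory where
  var y := if y = x then a else m.var y
  arr := m.arr

/-- Writing an entry of an array. -/
def Memory.setArr (m : Memory) (A i j a : ℕ) : Memory where
  var := m.var
  arr B i' j' := if B = A ∧ i' = i ∧ j' = j then a else m.arr B i' j'

/-- Expressions: constants, variables, array entries, sums, and truncated differences. -/
inductive Expr where
  | lit (a : ℕ)
  | var (x : ℕ)
  | arr (A : ℕ) (i j : Expr)
  | add (e f : Expr)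
  | sub (e f : Expr)

/-- The value of an expression. -/
def Expr.eval (m : Memory) : Expr → ℕ
  | .lit a => a
  | .var x => m.var x
  | .arr A i j => m.arr A (i.eval m) (j.eval m)
  | .add e f => e.eval m + f.eval m
  | .sub e f => e.eval m - f.eval m

/-- The cost of evaluating an expression: one step for each operation, constant and variable. -/
def Expr.cost : Expr → ℕ
  | .lit _ => 1
  | .var _ => 1
  | .arr _ i j => i.cost + j.cost + 1
  | .add e f => e.cost + f.cost + 1
  | .sub e f => e.cost + f.cost + 1

/-- Programs. A condition `e` counts as true if its value is not `0`. -/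
inductive Prog where
  | skip
  | setVar (x : ℕ) (e : Expr)
  | setArr (A : ℕ) (i j e : Expr)
  | seq (p q : Prog)
  | cond (e : Expr) (p q : Prog)
  | loop (e : Expr) (p : Prog)

/-- `Exec p m m' t`: the program `p`, started in the memory `m`, halts after exactly `t` steps in
the memory `m'`. -/
inductive Exec : Prog → Memory → Memory → ℕ → Prop
  | skip (m : Memory) : Exec .skip m m 1
  | setVar (m : Memory) (x : ℕ) (e : Expr) :
      Exec (.setVar x e) m (m.setVar x (e.eval m)) (e.cost + 1)
  | setArr (m : Memory) (A : ℕ) (i j e : Expr) :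
      Exec (.setArr A i j e) m (m.setArr A (i.eval m) (j.eval m) (e.eval m))
        (i.cost + j.cost + e.cost + 1)
  | seq {m m' m'' : Memory} {p q : Prog} {s t : ℕ} :
      Exec p m m' s → Exec q m' m'' t → Exec (.seq p q) m m'' (s + t)
  | condTrue {m m' : Memory} {e : Expr} {p q : Prog} {t : ℕ} :
      e.eval m ≠ 0 → Exec p m m' t → Exec (.cond e p q) m m' (e.cost + t + 1)
  | condFalse {m m' : Memory} {e : Expr} {p q : Prog} {t : ℕ} :
      e.eval m = 0 → Exec q m m' t → Exec (.cond e p q) m m' (e.cost + t + 1)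
  | loopStep {m m' m'' : Memory} {e : Expr} {p : Prog} {s t : ℕ} :
      e.eval m ≠ 0 → Exec p m m' s → Exec (.loop e p) m' m'' t →
      Exec (.loop e p) m m'' (e.cost + s + t + 1)
  | loopEnd {m : Memory} {e : Expr} {p : Prog} :
      e.eval m = 0 → Exec (.loop e p) m m (e.cost + 1)

open Classical in
/-- The initial memory: variables `0, 1, 2, 3` hold the number of nodes, the number of colors, the
start node and the bound; array `0` holds the adjacency matrix, and array `1` holds the color of
node `i` at position `(i, 0)`. Everything else is `0`. -/
def Instance.memory (I : Instance) : Memory where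
  var x :=
    if x = 0 then I.n
    else if x = 1 then I.k
    else if x = 2 then I.start
    else if x = 3 then I.bound
    else 0
  arr A i j :=
    if A = 0 then
      if ∃ (hi : i < I.n) (hj : j < I.n), I.graph.Adj ⟨i, hi⟩ ⟨j, hj⟩ then 1 else 0
    else if A = 1 then
      if h : i < I.n ∧ j = 0 then I.col ⟨i, h.1⟩ else 0
    else 0

open Classical in
/-- Honey-Bee-Solitaire can be solved in polynomial time on the instances with property `S`: there
are a single program and a polynomial such that on every instance with property `S` the program
halts, after a number of steps bounded by the polynomial in the size of the instance, with the
correct answer (`1` for YES, `0` for NO) in variable `0`. Nothing is required on other inputs. -/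
def SolvableInPolyTimeOn (S : Instance → Prop) : Prop :=
  ∃ (prog : Prog) (p : Polynomial ℕ), ∀ I : Instance, S I →
    ∃ (m : Memory) (t : ℕ), Exec prog I.memory m t ∧ t ≤ p.eval I.size ∧
      m.var 0 = if I.IsYes then 1 else 0

end HoneyBee

end

/-!
Call the start node, and every maximal monochromatic connected set of other nodes, a block:
conquering a node conquers its block. In a co-comparability graph, two blocks that neither are
equal nor adjacent ("do not touch") are comparable as a whole, so the blocks inherit a strict order
whose incomparability relation is touching. A walk that does not touch a block `x` stays on one
side of `x`. Hence a connected territory that contains `u` and `d` touches every block, except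
possibly those above both of `u` and `d` or below both of them, and it suffices to follow the two
ends of the territory instead of the territory itself.

Every color has to be completed by some call, so the length of a color sequence is the number of
colors plus the number of calls that complete no color. A call can be taken to complete its color if
every connected territory containing the two ends touches all nodes of the color. The optimum is
therefore a shortest path on the pairs of ends, in which such calls are free and all others cost
one. These costs can be read off the touching relation alone: whether a connected territory may
contain `u` and `d` without touching `x` is a reachability question. So the order on the nodes,
which is not part of the input, never has to be found.
-/

namespace HoneyBee

/-! ### Blocks -/

section Blocks

variable {V : Type*}

/-- The order that a strict order `r` induces on the connected components of a graph `B`, as a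
relation on the nodes: all of the component of `x` lies below all of the component of `y`. -/
def ComponentLT (B : SimpleGraph V) (r : V → V → Prop) (x y : V) : Prop :=
  ∀ x' y', B.Reachable x x' → B.Reachable y y' → r x' y'

section ComponentLT

variable {B : SimpleGraph V} {r : V → V → Prop} [IsStrictOrder V r]

instance : IsStrictOrder V (ComponentLT B r) where
  irrefl x h := irrefl x (h x x (.refl x) (.refl x))
  trans _ y _ hxy hyz x' z' hx hz :=
    _root_.trans (hxy x' y hx (.refl y)) (hyz y z' (.refl y) hz)

theorem rel_of_reachable (hB : B.Adj ≤ IncompRel r) {x x' y : V} (hx : B.Reachable x x')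
    (hcomp : ∀ z, B.Reachable x z → ¬ IncompRel r z y) (hxy : r x y) : r x' y := by
  have hx' := (SimpleGraph.reachable_iff_reflTransGen x x').1 hx
  clear hx
  induction hx' with
  | refl => exact hxy
  | @tail a b ha hab ih =>
    have hb := hcomp b ((SimpleGraph.reachable_iff_reflTransGen x b).2 (ha.tail hab))
    by_contra hby
    have hyb : r y b := by simpa [IncompRel, hby] using hb
    exact (hB a b hab).1 (_root_.trans ih hyb)

theorem componentLT_of_rel (hB : B.Adj ≤ IncompRel r) {x y : V}
    (hcomp : ∀ x' y', B.Reachable x x' → B.Reachable y y' → ¬ IncompRel r x' y') (hxy : r x y) :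
    ComponentLT B r x y := by
  intro x' y' hx hy
  have hx'y : r x' y := rel_of_reachable hB hx (fun z hz => hcomp z y hz (.refl y)) hxy
  refine rel_of_reachable (r := Function.swap r) ?_ hy (fun z hz h => ?_) hx'y
  · rwa [incompRel_swap]
  · exact hcomp x' z hx hz ((incompRel_swap_apply r).1 h.symm)

theorem incompRel_componentLT_iff (hB : B.Adj ≤ IncompRel r) {x y : V} :
    IncompRel (ComponentLT B r) x y ↔
      ∃ x' y', B.Reachable x x' ∧ IncompRel r x' y' ∧ B.Reachable y' y := by
  constructor
  · rintro ⟨hxy, hyx⟩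
    by_contra! hcomp
    have hcomp' : ∀ x' y', B.Reachable x x' → B.Reachable y y' → ¬ IncompRel r x' y' :=
      fun x' y' hx hy h => hcomp x' y' hx h hy.symm
    rcases not_incompRel_iff_symmGen.1 (hcomp' x y (.refl x) (.refl y)) with h | h
    · exact hxy (componentLT_of_rel hB hcomp' h)
    · exact hyx (componentLT_of_rel hB (fun y' x' hy hx h' => hcomp' x' y' hx hy h'.symm) h)
  · rintro ⟨x', y', hx, h, hy⟩
    exact ⟨fun hlt => h.1 (hlt x' y' hx hy.symm), fun hlt => h.2 (hlt y' x' hy.symm hx)⟩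

end ComponentLT

variable {C : Type*} {G : SimpleGraph V} {col : V → C} {v₀ : V}

/-- The nodes of color `c` other than the start node `v₀`, which is conquered from the outset. -/
def colorClass (col : V → C) (v₀ : V) (c : C) : Set V := {x | x ≠ v₀ ∧ col x = c}

/-- The graph whose connected components are the blocks: `{v₀}`, and the maximal connected
monochromatic sets of nodes other than `v₀`. -/
def blockGraph (G : SimpleGraph V) (col : V → C) (v₀ : V) : SimpleGraph V where
  Adj x y := G.Adj x y ∧ col x = col y ∧ x ≠ v₀ ∧ y ≠ v₀
  symm := ⟨fun _ _ ⟨hadj, hcol, hx, hy⟩ => ⟨hadj.symm, hcol.symm, hy, hx⟩⟩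
  loopless := ⟨fun _ h => G.irrefl h.1⟩

/-- `x` and `y` belong to the same block. -/
abbrev SameBlock (G : SimpleGraph V) (col : V → C) (v₀ x y : V) : Prop :=
  (blockGraph G col v₀).Reachable x y

/-- `x` and `y` touch if their blocks are equal or adjacent. -/
def Touch (G : SimpleGraph V) (col : V → C) (v₀ x y : V) : Prop :=
  ∃ x' y', SameBlock G col v₀ x x' ∧ (x' = y' ∨ G.Adj x' y') ∧ SameBlock G col v₀ y' y

theorem SameBlock.mem_colorClass {x y : V} {c : C} (h : SameBlock G col v₀ x y)
    (hx : x ∈ colorClass col v₀ c) : y ∈ colorClass col v₀ c := by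
  rw [SameBlock, SimpleGraph.reachable_iff_reflTransGen] at h
  induction h with
  | refl => exact hx
  | tail _ hab ih => exact ⟨hab.2.2.2, hab.2.1.symm.trans ih.2⟩

theorem SameBlock.eq_start {y : V} (h : SameBlock G col v₀ v₀ y) : y = v₀ := by
  by_contra hy
  exact (SameBlock.mem_colorClass h.symm ⟨hy, rfl⟩).1 rfl

instance : Std.Refl (Touch G col v₀) where
  refl x := ⟨x, x, .refl x, .inl rfl, .refl x⟩

instance : Std.Symm (Touch G col v₀) where
  symm := fun _ _ ⟨x', y', hx, h, hy⟩ => ⟨y', x', hy.symm, h.imp Eq.symm (·.symm), hx.symm⟩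

theorem Touch.trans_sameBlock {x y z : V} (hxy : Touch G col v₀ x y)
    (hyz : SameBlock G col v₀ y z) : Touch G col v₀ x z :=
  let ⟨x', y', hx, h, hy⟩ := hxy
  ⟨x', y', hx, h, hy.trans hyz⟩

/-- The relation `T` does not distinguish two related nodes of the same color class. -/
def MergesColors (T : V → V → Prop) (col : V → C) (v₀ : V) : Prop :=
  ∀ c, ∀ x ∈ colorClass col v₀ c, ∀ y ∈ colorClass col v₀ c, T x y → T x ≤ T y

theorem mergesColors_touch : MergesColors (Touch G col v₀) col v₀ := by
  rintro c x hx y hy ⟨x', y', hxx', h, hyy'⟩ z hxz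
  have hx' := hxx'.mem_colorClass hx
  have hy' := SameBlock.mem_colorClass hyy'.symm hy
  have hsame : SameBlock G col v₀ x' y' := by
    rcases h with rfl | h
    · exact .refl x'
    · exact SimpleGraph.Adj.reachable ⟨h, hx'.2.trans hy'.2.symm, hx'.1, hy'.1⟩
  exact symm ((symm hxz).trans_sameBlock (hxx'.trans (hsame.trans hyy')))

theorem exists_strictOrder_incompRel_eq_touch (hG : IsCocomparability G) (col : V → C) (v₀ : V) :
    ∃ r : V → V → Prop, IsStrictOrder V r ∧ IncompRel r = Touch G col v₀ := by
  obtain ⟨P, hP⟩ := hG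
  have hincomp : ∀ x y : V, x = y ∨ G.Adj x y ↔ IncompRel P.lt x y := by
    intro x y
    rw [hP, IncompRel]
    by_cases hxy : x = y
    · simp [hxy]
    · simp [hxy]
  refine ⟨ComponentLT (blockGraph G col v₀) P.lt, inferInstance, ?_⟩
  have hblock : (blockGraph G col v₀).Adj ≤ IncompRel P.lt :=
    fun x y hxy => (hincomp x y).1 (.inr hxy.1)
  ext x y
  rw [incompRel_componentLT_iff hblock]
  simp only [Touch, hincomp]

end Blocks

/-! ### The game in terms of touching -/

section Game

variable {V C : Type*} {T : V → V → Prop} {col : V → C} {v₀ : V} {W W' : Set V} {c : C}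

/-- The territory `W` after calling the color `c`, where `T` is the relation of touching. -/
def call (T : V → V → Prop) (col : V → C) (v₀ : V) (W : Set V) (c : C) : Set V :=
  W ∪ {x ∈ colorClass col v₀ c | ∃ w ∈ W, T w x}

/-- The territory conquered by the color sequence `γ`, where `T` is the relation of touching. -/
def territory (T : V → V → Prop) (col : V → C) (v₀ : V) (γ : List C) : Set V :=
  γ.foldl (call T col v₀) {v₀}

theorem subset_call : W ⊆ call T col v₀ W c := Set.subset_union_left

theorem mem_colorClass_of_mem_call {x : V} (hx : x ∈ call T col v₀ W c) (hxW : x ∉ W) :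
    x ∈ colorClass col v₀ c :=
  (hx.resolve_left hxW).1

theorem call_mono (h : W ⊆ W') : call T col v₀ W c ⊆ call T col v₀ W' c :=
  Set.union_subset_union h fun _ ⟨hx, w, hw, hwx⟩ => ⟨hx, w, h hw, hwx⟩

theorem exists_rel_of_mem_call [Std.Refl T] {x : V} (hx : x ∈ call T col v₀ W c) :
    ∃ w ∈ W, T w x := by
  rcases hx with hx | ⟨-, hx⟩
  · exact ⟨x, hx, refl x⟩
  · exact hx

theorem subset_foldl_call (γ : List C) (W : Set V) : W ⊆ γ.foldl (call T col v₀) W := by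
  induction γ generalizing W with
  | nil => exact subset_rfl
  | cons c γ ih => exact subset_call.trans (ih _)

theorem call_subset_foldl_call {γ : List C} (hc : c ∈ γ) (W : Set V) :
    call T col v₀ W c ⊆ γ.foldl (call T col v₀) W := by
  induction γ generalizing W with
  | nil => simp at hc
  | cons a γ ih =>
    rcases List.mem_cons.1 hc with rfl | hc
    · exact subset_foldl_call γ _
    · exact (call_mono subset_call).trans (ih hc _)

section Graph

variable {G : SimpleGraph V}

theorem setNbhd_subset_call (h₀ : v₀ ∈ W) :
    setNbhd G col W c ⊆ call (Touch G col v₀) col v₀ W c := by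
  intro x hx
  simp only [setNbhd, nodeNbhd, Set.mem_iUnion, Set.mem_ofPred_eq] at hx
  obtain ⟨w, hw, hx⟩ := hx
  have hstep : ∀ y z, y ∈ call (Touch G col v₀) col v₀ W c → G.Adj y z → col z = c →
      z ∈ call (Touch G col v₀) col v₀ W c := by
    intro y z hy hyz hz
    by_cases hz₀ : z = v₀
    · exact .inl (hz₀ ▸ h₀)
    rcases hy with hy | ⟨hy, w', hw', hw'y⟩
    · exact .inr ⟨⟨hz₀, hz⟩, y, hy, y, z, .refl y, .inr hyz, .refl z⟩
    · have hblock : (blockGraph G col v₀).Adj y z := ⟨hyz, hy.2.trans hz.symm, hy.1, hz₀⟩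
      exact .inr ⟨⟨hz₀, hz⟩, w', hw', hw'y.trans_sameBlock hblock.reachable⟩
  induction hx with
  | single h => exact hstep _ _ (.inl hw) h.1 h.2
  | tail _ h ih => exact hstep _ _ ih h.1 h.2

theorem SameBlock.reflTransGen {x y : V} (hxy : SameBlock G col v₀ x y)
    (hx : x ∈ colorClass col v₀ c) :
    Relation.ReflTransGen (fun a b => G.Adj a b ∧ col b = c) x y := by
  rw [SameBlock, SimpleGraph.reachable_iff_reflTransGen] at hxy
  induction hxy with
  | refl => exact .refl
  | @tail a b hxa hab ih =>
    have ha : SameBlock G col v₀ x a := (SimpleGraph.reachable_iff_reflTransGen x a).2 hxa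
    exact ih.tail ⟨hab.1, hab.2.1 ▸ (ha.mem_colorClass hx).2⟩

theorem union_setNbhd_eq_call (h₀ : v₀ ∈ W) (hW : ∀ x ∈ W, ∀ y, SameBlock G col v₀ x y → y ∈ W) :
    W ∪ setNbhd G col W c = call (Touch G col v₀) col v₀ W c := by
  refine (Set.union_subset subset_call (setNbhd_subset_call h₀)).antisymm ?_
  rintro x (hx | ⟨hx, w, hw, w', x', hww', h, hx'x⟩)
  · exact .inl hx
  have hw' := hW w hw w' hww'
  rcases h with rfl | h
  · exact .inl (hW w' hw' x hx'x)
  · have hx' : x' ∈ colorClass col v₀ c := SameBlock.mem_colorClass hx'x.symm hx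
    simp only [setNbhd, nodeNbhd, Set.mem_union, Set.mem_iUnion, Set.mem_ofPred_eq]
    exact .inr ⟨w', hw', Relation.TransGen.trans_left (.single ⟨h, hx'.2⟩)
      (SameBlock.reflTransGen hx'x hx')⟩

theorem conquered_eq_foldl_call (γ : List C) (h₀ : v₀ ∈ W)
    (hW : ∀ x ∈ W, ∀ y, SameBlock G col v₀ x y → y ∈ W) :
    conquered G col W γ = γ.foldl (call (Touch G col v₀) col v₀) W := by
  induction γ generalizing W with
  | nil => rfl
  | cons c γ ih =>
    simp only [conquered, List.foldl_cons] at ih ⊢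
    rw [union_setNbhd_eq_call h₀ hW]
    refine ih (subset_call h₀) ?_
    rintro x (hx | ⟨hx, w, hw, hwx⟩) y hxy
    · exact .inl (hW x hx y hxy)
    · exact .inr ⟨hxy.mem_colorClass hx, w, hw, hwx.trans_sameBlock hxy⟩

theorem conquered_start_eq_territory (G : SimpleGraph V) (col : V → C) (v₀ : V) (γ : List C) :
    conquered G col {v₀} γ = territory (Touch G col v₀) col v₀ γ :=
  conquered_eq_foldl_call γ rfl (by rintro x rfl y hxy; exact hxy.eq_start)

end Graph

/-! ### Connected territories and their ends -/

/-- `a` and `b` are connected by a walk along `T` inside the set `S`. -/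
def LinkedIn (T : V → V → Prop) (S : Set V) (a b : V) : Prop :=
  Relation.TransGen (fun x y => T x y ∧ x ∈ S ∧ y ∈ S) a b

theorem LinkedIn.mono {S S' : Set V} {a b : V} (h : LinkedIn T S a b) (hS : S ⊆ S') :
    LinkedIn T S' a b :=
  Relation.TransGen.mono (fun _ _ ⟨hT, hx, hy⟩ => ⟨hT, hS hx, hS hy⟩) a b h

/-- `a` and `b` are connected by a walk along `T` that does not touch `x`. -/
abbrev LinkedAvoiding (T : V → V → Prop) (x a b : V) : Prop := LinkedIn T {y | ¬ T x y} a b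

/-- The territory `W` is connected with respect to `T`. -/
def IsLinked (T : V → V → Prop) (W : Set V) : Prop := ∀ a ∈ W, ∀ b ∈ W, LinkedIn T W a b

/-- One end of the territory moves from `u` to `u'` when the color `c` is called. -/
def Move (T : V → V → Prop) (col : V → C) (v₀ : V) (c : C) (u u' : V) : Prop :=
  u' = u ∨ T u u' ∧ u' ∈ colorClass col v₀ c

open Classical in
/-- The cost of calling `c` when the territory has the ends `u` and `d`. The call is free of charge
if every connected territory that contains `u` and `d` touches all nodes of color `c`, so that the
call completes this color. -/
noncomputable def moveCost (T : V → V → Prop) (col : V → C) (v₀ : V) (c : C) (u d : V) : ℕ :=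
  if ∃ x ∈ colorClass col v₀ c, LinkedAvoiding T x u d then 1 else 0

/-- Every connected territory that contains `u` and `d` touches all nodes. -/
def IsGoal (T : V → V → Prop) (u d : V) : Prop := ∀ x, ¬ LinkedAvoiding T x u d

/-- `MoveSeq T col v₀ r N u d`: a sequence of `r` moves of total cost `N` leads from the ends
`(v₀, v₀)` to the ends `(u, d)`. -/
inductive MoveSeq (T : V → V → Prop) (col : V → C) (v₀ : V) : ℕ → ℕ → V → V → Prop
  | nil : MoveSeq T col v₀ 0 0 v₀ v₀
  | step {r N : ℕ} {u d u' d' : V} {c : C} : MoveSeq T col v₀ r N u d →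
      (colorClass col v₀ c).Nonempty → Move T col v₀ c u u' → Move T col v₀ c d d' →
      MoveSeq T col v₀ (r + 1) (N + moveCost T col v₀ c u d) u' d'

theorem moveCost_le_one (u d : V) : moveCost T col v₀ c u d ≤ 1 := by
  unfold moveCost
  split_ifs <;> simp

theorem Move.mem_call {a b : V} (h : Move T col v₀ c a b) (ha : a ∈ W) :
    b ∈ call T col v₀ W c := by
  rcases h with rfl | ⟨hab, hb⟩
  · exact .inl ha
  · exact .inr ⟨hb, a, ha, hab⟩

theorem IsLinked.call [Std.Refl T] [Std.Symm T] (h : IsLinked T W) :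
    IsLinked T (call T col v₀ W c) := by
  intro a ha b hb
  obtain ⟨w, hw, hwa⟩ := exists_rel_of_mem_call ha
  obtain ⟨w', hw', hwb⟩ := exists_rel_of_mem_call hb
  exact .head ⟨symm hwa, ha, subset_call hw⟩
    (.tail ((h w hw w' hw').mono subset_call) ⟨hwb, subset_call hw', hb⟩)

theorem IsLinked.exists_rel [Std.Symm T] (h : IsLinked T W) {u d x : V} (hu : u ∈ W) (hd : d ∈ W)
    (hx : ¬ LinkedAvoiding T x u d) : ∃ w ∈ W, T w x := by
  by_contra! hn
  exact hx ((h u hu d hd).mono fun w hw hxw => hn w hw (symm hxw))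

section Complete

variable [Fintype V]

open Classical in
/-- The colors of the nodes other than `v₀`. -/
noncomputable def colors (col : V → C) (v₀ : V) : Finset C := {x | x ≠ v₀}.toFinset.image col

open Classical in
/-- The colors all of whose nodes belong to the territory `W`. -/
noncomputable def complete (col : V → C) (v₀ : V) (W : Set V) : Finset C :=
  {c ∈ colors col v₀ | colorClass col v₀ c ⊆ W}

theorem mem_colors : c ∈ colors col v₀ ↔ (colorClass col v₀ c).Nonempty := by
  simp [colors, colorClass, Set.Nonempty]

theorem mem_complete : c ∈ complete col v₀ W ↔ c ∈ colors col v₀ ∧ colorClass col v₀ c ⊆ W := by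
  simp [complete]

theorem complete_mono (h : W ⊆ W') : complete col v₀ W ⊆ complete col v₀ W' := fun _ hc =>
  mem_complete.2 ((mem_complete.1 hc).imp_right (·.trans h))

theorem complete_univ : complete col v₀ Set.univ = colors col v₀ := by
  ext c
  simp [mem_complete]

theorem complete_start : complete col v₀ {v₀} = ∅ := by
  refine Finset.eq_empty_of_forall_notMem fun c hc => ?_
  obtain ⟨hcolors, hsub⟩ := mem_complete.1 hc
  obtain ⟨x, hx⟩ := mem_colors.1 hcolors
  exact hx.1 (hsub hx)

theorem mem_complete_of_mem_complete_call {a : C} (hac : a ≠ c)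
    (ha : a ∈ complete col v₀ (call T col v₀ W c)) : a ∈ complete col v₀ W := by
  obtain ⟨hcolors, hsub⟩ := mem_complete.1 ha
  refine mem_complete.2 ⟨hcolors, fun x hx => ?_⟩
  by_contra hxW
  exact hac (hx.2.symm.trans (mem_colorClass_of_mem_call (hsub hx) hxW).2)

theorem card_complete_call_le_of_notMem (hc : c ∉ complete col v₀ (call T col v₀ W c)) :
    (complete col v₀ (call T col v₀ W c)).card ≤ (complete col v₀ W).card :=
  Finset.card_le_card fun _ ha =>
    mem_complete_of_mem_complete_call (ne_of_mem_of_not_mem ha hc) ha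

theorem card_complete_call_le :
    (complete col v₀ (call T col v₀ W c)).card ≤ (complete col v₀ W).card + 1 := by
  classical
  refine (Finset.card_le_card fun a ha => ?_).trans (Finset.card_insert_le c _)
  exact Finset.mem_insert.2
    (or_iff_not_imp_left.2 fun hac => mem_complete_of_mem_complete_call hac ha)

theorem card_complete_add_one_le [Std.Symm T] (hW : IsLinked T W) {u d : V} (hu : u ∈ W)
    (hd : d ∈ W) (hcolors : c ∈ colors col v₀) (hc : c ∉ complete col v₀ W) :
    (complete col v₀ W).card + 1 ≤
      moveCost T col v₀ c u d + (complete col v₀ (call T col v₀ W c)).card := by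
  have hmono : complete col v₀ W ⊆ complete col v₀ (call T col v₀ W c) :=
    complete_mono subset_call
  by_cases hcost : ∃ x ∈ colorClass col v₀ c, LinkedAvoiding T x u d
  · rw [moveCost, if_pos hcost, add_comm]
    exact Nat.add_le_add_left (Finset.card_le_card hmono) 1
  · rw [moveCost, if_neg hcost, zero_add]
    refine Finset.card_lt_card ((Finset.ssubset_iff_of_subset hmono).2 ⟨c, ?_, hc⟩)
    refine mem_complete.2 ⟨hcolors, fun x hx => .inr ⟨hx, hW.exists_rel hu hd fun hlinked => ?_⟩⟩
    exact hcost ⟨x, hx, hlinked⟩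

theorem MoveSeq.exists_territory [Std.Refl T] [Std.Symm T] {r N : ℕ} {u d : V}
    (h : MoveSeq T col v₀ r N u d) : ∃ γ : List C, IsLinked T (territory T col v₀ γ) ∧
      u ∈ territory T col v₀ γ ∧ d ∈ territory T col v₀ γ ∧
      γ.length ≤ N + (complete col v₀ (territory T col v₀ γ)).card := by
  induction h with
  | nil =>
    refine ⟨[], ?_, rfl, rfl, by simp⟩
    rintro a rfl b rfl
    exact .single ⟨refl _, rfl, rfl⟩
  | @step _ N u d u' d' c _ hcolors hu hd ih =>
    obtain ⟨γ, hlinked, huW, hdW, hlen⟩ := ih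
    set W := territory T col v₀ γ with hW
    by_cases hc : c ∈ complete col v₀ W
    · have hcall : call T col v₀ W c ⊆ W :=
        Set.union_subset subset_rfl fun x hx => (mem_complete.1 hc).2 hx.1
      exact ⟨γ, hlinked, hcall (hu.mem_call huW), hcall (hd.mem_call hdW),
        hlen.trans (Nat.add_le_add_right (Nat.le_add_right N _) _)⟩
    · have hcard := card_complete_add_one_le hlinked huW hdW (mem_colors.2 hcolors) hc
      have happend : territory T col v₀ (γ ++ [c]) = call T col v₀ W c := by simp [hW, territory]
      refine ⟨γ ++ [c], ?_⟩
      rw [happend, List.length_append, List.length_singleton]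
      exact ⟨hlinked.call, hu.mem_call huW, hd.mem_call hdW, by omega⟩

theorem MoveSeq.exists_territory_eq_univ [Std.Refl T] [Std.Symm T] {r N b : ℕ} {u d : V}
    (h : MoveSeq T col v₀ r N u d) (hgoal : IsGoal T u d) (hb : N + (colors col v₀).card ≤ b) :
    ∃ γ : List C, γ.length = b ∧ territory T col v₀ γ = Set.univ := by
  classical
  obtain ⟨γ, hlinked, hu, hd, hlen⟩ := h.exists_territory
  set W := territory T col v₀ γ
  let δ := (colors col v₀ \ complete col v₀ W).toList
  have hδ : δ.length + (complete col v₀ W).card = (colors col v₀).card := by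
    rw [Finset.length_toList]
    exact Finset.card_sdiff_add_card_eq_card (Finset.filter_subset _ _)
  refine ⟨γ ++ δ ++ List.replicate (b - (γ ++ δ).length) (col v₀), ?_, ?_⟩
  · simp only [List.length_append, List.length_replicate]
    omega
  · refine Set.eq_univ_of_forall fun x => ?_
    rw [territory, List.foldl_append, List.foldl_append]
    refine subset_foldl_call _ _ ?_
    by_cases hx : x = v₀
    · exact subset_foldl_call _ _ (subset_foldl_call γ _ hx)
    by_cases hc : col x ∈ complete col v₀ W
    · exact subset_foldl_call _ _ ((mem_complete.1 hc).2 ⟨hx, rfl⟩)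
    · have hcδ : col x ∈ δ :=
        Finset.mem_toList.2 (Finset.mem_sdiff.2 ⟨mem_colors.2 ⟨x, hx, rfl⟩, hc⟩)
      exact call_subset_foldl_call hcδ W
        (.inr ⟨⟨hx, rfl⟩, hlinked.exists_rel hu hd (hgoal x)⟩)

end Complete

section Order

variable {r : V → V → Prop}

/-- `u` dominates `v` with respect to the strict order `r`: all nodes above `u` are above `v`. -/
def Dominates (r : V → V → Prop) (u v : V) : Prop := ∀ x, r u x → r v x

theorem Dominates.trans {u v w : V} (huv : Dominates r u v) (hvw : Dominates r v w) :
    Dominates r u w := fun x hx => hvw x (huv x hx)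

theorem Dominates.not_rel {u v w : V} (h : Dominates r u w) (hwv : IncompRel r w v) : ¬ r u v :=
  fun huv => hwv.1 (h v huv)

variable [IsStrictOrder V r]

theorem dominates_of_rel {u v : V} (h : r v u) : Dominates r u v := fun _ hx => _root_.trans h hx

theorem dominates_of_incompRel_le {x y : V} (hxy : IncompRel r x y)
    (hle : IncompRel r y ≤ IncompRel r x) : Dominates r x y := by
  intro z hxz
  by_contra hyz
  by_cases hzy : r z y
  · exact hxy.1 (_root_.trans hxz hzy)
  · exact (hle z ⟨hyz, hzy⟩).1 hxz

theorem LinkedAvoiding.rel_or_rel {x u d : V} (h : LinkedAvoiding (IncompRel r) x u d) :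
    (r u x ∧ r d x) ∨ (r x u ∧ r x d) := by
  have hstep : ∀ {a b}, IncompRel r a b ∧ ¬ IncompRel r x a ∧ ¬ IncompRel r x b →
      (r a x ∧ r b x) ∨ (r x a ∧ r x b) := by
    rintro a b ⟨hab, hxa, hxb⟩
    have haxb : r a x → r x b → r a b := _root_.trans
    have hbxa : r b x → r x a → r b a := _root_.trans
    unfold IncompRel at hab hxa hxb
    tauto
  induction h with
  | single h => exact hstep h
  | @tail b c _ h ih =>
    have hbc := hstep h
    have hasymm : ¬ (r b x ∧ r x b) := fun h => _root_.asymm h.1 h.2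
    tauto

theorem exists_maximal_dominates [Finite V] (hT : MergesColors (IncompRel r) col v₀)
    (hne : (colorClass col v₀ c).Nonempty) : ∃ m ∈ colorClass col v₀ c,
      ∀ x ∈ colorClass col v₀ c, Dominates r m x ∧ Dominates (Function.swap r) x m := by
  obtain ⟨m, hm, hmax⟩ :=
    (Finite.wellFounded_of_trans_of_irrefl (Function.swap r)).has_min (colorClass col v₀ c) hne
  refine ⟨m, hm, fun x hx => ?_⟩
  by_cases hxm : r x m
  · exact ⟨dominates_of_rel hxm, dominates_of_rel hxm⟩
  · have hinc : IncompRel r m x := ⟨hmax x hx, hxm⟩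
    refine ⟨dominates_of_incompRel_le hinc (hT c x hx m hm hinc.symm), ?_⟩
    refine dominates_of_incompRel_le ?_ ?_ <;> rw [incompRel_swap]
    · exact hinc.symm
    · exact hT c m hm x hx hinc

theorem Dominates.exists_move {u w v : V} (h : Dominates r u w) (hwv : IncompRel r w v)
    (hv : v ∈ colorClass col v₀ c) :
    ∃ u', Move (IncompRel r) col v₀ c u u' ∧ Dominates r u' v := by
  have huv := h.not_rel hwv
  by_cases hvu : r v u
  · exact ⟨u, .inl rfl, dominates_of_rel hvu⟩
  · exact ⟨v, .inr ⟨⟨huv, hvu⟩, hv⟩, fun _ hx => hx⟩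

theorem exists_move_of_mem_call {v : V} (hv : v ∈ call (IncompRel r) col v₀ W c) :
    ∃ w ∈ W, ∀ u, Dominates r u w →
      ∃ u', Move (IncompRel r) col v₀ c u u' ∧ Dominates r u' v := by
  rcases hv with hv | ⟨hv, w, hw, hwv⟩
  · exact ⟨v, hv, fun u hu => ⟨u, .inl rfl, hu⟩⟩
  · exact ⟨w, hw, fun u hu => hu.exists_move hwv hv⟩

theorem exists_move_of_colorClass_subset_call [Finite V] (hT : MergesColors (IncompRel r) col v₀)
    (hne : (colorClass col v₀ c).Nonempty)
    (hc : colorClass col v₀ c ⊆ call (IncompRel r) col v₀ W c) {v : V}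
    (hv : v ∈ call (IncompRel r) col v₀ W c) :
    ∃ w ∈ W, ∀ u, Dominates r u w → (∀ x ∈ colorClass col v₀ c, ¬ r u x) ∧
      ∃ u', Move (IncompRel r) col v₀ c u u' ∧ Dominates r u' v := by
  obtain ⟨m, hm, hmax⟩ := exists_maximal_dominates hT hne
  have hlt_max : ∀ x ∈ colorClass col v₀ c, ∀ u, r u x → r u m := fun x hx => (hmax x hx).2
  by_cases hmv : Dominates r m v
  · obtain ⟨w, hw, hwm⟩ := exists_rel_of_mem_call (hc hm)
    refine ⟨w, hw, fun u hu => ⟨fun x hx hux => hu.not_rel hwm (hlt_max x hx u hux), ?_⟩⟩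
    obtain ⟨u', hmove, hu'⟩ := hu.exists_move hwm hm
    exact ⟨u', hmove, hu'.trans hmv⟩
  · have hvW : v ∈ W := by
      by_contra hvW
      exact hmv (hmax v (mem_colorClass_of_mem_call hv hvW)).1
    refine ⟨v, hvW, fun u hu => ⟨fun x hx hux => hmv ?_, u, .inl rfl, hu⟩⟩
    exact dominates_of_rel (hu m (hlt_max x hx u hux))

variable [Fintype V]

theorem exists_moves_of_mem_call (hT : MergesColors (IncompRel r) col v₀)
    (hcolors : c ∈ colors col v₀) {v v' : V} (hv : v ∈ call (IncompRel r) col v₀ W c)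
    (hv' : v' ∈ call (IncompRel r) col v₀ W c) :
    ∃ w ∈ W, ∃ w' ∈ W, ∀ u d, Dominates r u w → Dominates (Function.swap r) d w' →
      moveCost (IncompRel r) col v₀ c u d +
        (complete col v₀ (call (IncompRel r) col v₀ W c)).card ≤ (complete col v₀ W).card + 1 ∧
      ∃ u' d', Move (IncompRel r) col v₀ c u u' ∧ Move (IncompRel r) col v₀ c d d' ∧
        Dominates r u' v ∧ Dominates (Function.swap r) d' v' := by
  have hswap : IncompRel (Function.swap r) = IncompRel r := incompRel_swap r
  by_cases hc : c ∈ complete col v₀ (call (IncompRel r) col v₀ W c)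
  · have hne := mem_colors.1 hcolors
    have hsub := (mem_complete.1 hc).2
    obtain ⟨w, hw, hup⟩ := exists_move_of_colorClass_subset_call hT hne hsub hv
    obtain ⟨w', hw', hdown⟩ := exists_move_of_colorClass_subset_call (r := Function.swap r)
      (W := W) (v := v') (hswap ▸ hT) hne (hswap ▸ hsub) (hswap ▸ hv')
    refine ⟨w, hw, w', hw', fun u d hu hd => ⟨?_, ?_⟩⟩
    · have hcost : moveCost (IncompRel r) col v₀ c u d = 0 := by
        refine if_neg fun ⟨x, hx, hlinked⟩ => ?_
        rcases hlinked.rel_or_rel with h | h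
        · exact (hup u hu).1 x hx h.1
        · exact (hdown d hd).1 x hx h.2
      rw [hcost, zero_add]
      exact card_complete_call_le
    · obtain ⟨-, u', hmove, hu'⟩ := hup u hu
      obtain ⟨-, d', hmove', hd'⟩ := hdown d hd
      exact ⟨u', d', hmove, hswap ▸ hmove', hu', hd'⟩
  · obtain ⟨w, hw, hup⟩ := exists_move_of_mem_call hv
    obtain ⟨w', hw', hdown⟩ := exists_move_of_mem_call (r := Function.swap r) (W := W) (v := v')
      (hswap ▸ hv')
    refine ⟨w, hw, w', hw', fun u d hu hd => ⟨?_, ?_⟩⟩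
    · rw [add_comm]
      exact add_le_add (card_complete_call_le_of_notMem hc) (moveCost_le_one u d)
    · obtain ⟨u', hmove, hu'⟩ := hup u hu
      obtain ⟨d', hmove', hd'⟩ := hdown d hd
      exact ⟨u', d', hmove, hswap ▸ hmove', hu', hd'⟩

theorem exists_moveSeq_of_mem_territory (hT : MergesColors (IncompRel r) col v₀) (γ : List C) :
    ∀ v ∈ territory (IncompRel r) col v₀ γ, ∀ v' ∈ territory (IncompRel r) col v₀ γ,
      ∃ k N u d, MoveSeq (IncompRel r) col v₀ k N u d ∧
        k + 1 ≤ (territory (IncompRel r) col v₀ γ).ncard ∧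
        N + (complete col v₀ (territory (IncompRel r) col v₀ γ)).card ≤ γ.length ∧
        Dominates r u v ∧ Dominates (Function.swap r) d v' := by
  induction γ using List.reverseRecOn with
  | nil =>
    rintro v rfl v' rfl
    refine ⟨0, 0, v', v', .nil, ?_, ?_, fun _ hx => hx, fun _ hx => hx⟩
    · simp [territory]
    · simp [territory, complete_start]
  | append_singleton γ c ih =>
    have happend : territory (IncompRel r) col v₀ (γ ++ [c]) =
      call (IncompRel r) col v₀ (territory (IncompRel r) col v₀ γ) c := by simp [territory]
    rw [happend, List.length_append, List.length_singleton]
    set W := territory (IncompRel r) col v₀ γ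
    intro v hv v' hv'
    rcases (subset_call (T := IncompRel r)).eq_or_ssubset with hW | hW
    · rw [← hW] at hv hv' ⊢
      obtain ⟨k, N, u, d, hseq, hk, hN, hends⟩ := ih v hv v' hv'
      exact ⟨k, N, u, d, hseq, hk, hN.trans (Nat.le_succ _), hends⟩
    · have hcard := Set.ncard_lt_ncard hW (Set.toFinite _)
      obtain ⟨y, hy, hyW⟩ := Set.exists_of_ssubset hW
      have hne : (colorClass col v₀ c).Nonempty := ⟨y, mem_colorClass_of_mem_call hy hyW⟩
      obtain ⟨w, hw, w', hw', hmoves⟩ := exists_moves_of_mem_call hT (mem_colors.2 hne) hv hv'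
      obtain ⟨k, N, u, d, hseq, hk, hN, hu, hd⟩ := ih w hw w' hw'
      obtain ⟨hcost, u', d', hmove, hmove', hu', hd'⟩ := hmoves u d hu hd
      exact ⟨k + 1, _, u', d', .step hseq hne hmove hmove', by omega, by omega, hu', hd'⟩

theorem exists_moveSeq_of_territory_eq_univ (hT : MergesColors (IncompRel r) col v₀) {γ : List C}
    (hγ : territory (IncompRel r) col v₀ γ = Set.univ) :
    ∃ k N u d, MoveSeq (IncompRel r) col v₀ k N u d ∧ IsGoal (IncompRel r) u d ∧
      k ≤ Fintype.card V ∧ N + (colors col v₀).card ≤ γ.length := by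
  obtain ⟨v, -, hv⟩ :=
    (Finite.wellFounded_of_trans_of_irrefl (Function.swap r)).has_min Set.univ ⟨v₀, trivial⟩
  obtain ⟨v', -, hv'⟩ :=
    (Finite.wellFounded_of_trans_of_irrefl r).has_min Set.univ ⟨v₀, trivial⟩
  obtain ⟨k, N, u, d, hseq, hk, hN, hu, hd⟩ :=
    exists_moveSeq_of_mem_territory hT γ v (hγ ▸ trivial) v' (hγ ▸ trivial)
  rw [hγ, Set.ncard_univ, Nat.card_eq_fintype_card] at hk
  rw [hγ, complete_univ] at hN
  refine ⟨k, N, u, d, hseq, fun x hlinked => ?_, by omega, hN⟩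
  rcases hlinked.rel_or_rel with h | h
  · exact hv x trivial (hu x h.1)
  · exact hv' x trivial (hd x h.2)

end Order

end Game

/-! ### Loop programs -/

/-- Programs that write arrays only, and whose loops let a variable run over the numbers below the
value of variable `0`, the number of nodes. They always halt, so a function describes their
effect. -/
inductive LoopProg where
  | setArr (A : ℕ) (i j e : Expr)
  | seq (p q : LoopProg)
  | when (e : Expr) (p : LoopProg)
  | loop (x : ℕ) (p : LoopProg)

/-- The expression `e` counts as true as a condition. -/
def Expr.Holds (e : Expr) (m : Memory) : Prop := e.eval m ≠ 0

instance (e : Expr) (m : Memory) : Decidable (e.Holds m) := instDecidableNot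

namespace LoopProg

/-- The program of the random access machine for a loop program. -/
def compile : LoopProg → Prog
  | .setArr A i j e => .setArr A i j e
  | .seq p q => .seq p.compile q.compile
  | .when e p => .cond e p.compile .skip
  | .loop x p => .seq (.setVar x (.lit 0)) (.loop (.sub (.var 0) (.var x))
      (.seq p.compile (.setVar x (.add (.var x) (.lit 1)))))

/-- The memory after `j` rounds of a loop with variable `x` whose body has the effect `f`. -/
def rounds (f : Memory → Memory) (x : ℕ) (m : Memory) : ℕ → Memory
  | 0 => m.setVar x 0
  | j + 1 => (f (rounds f x m j)).setVar x (j + 1)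

/-- The effect of a loop program on the memory. -/
def run : LoopProg → Memory → Memory
  | .setArr A i j e, m => m.setArr A (i.eval m) (j.eval m) (e.eval m)
  | .seq p q, m => q.run (p.run m)
  | .when e p, m => if e.Holds m then p.run m else m
  | .loop x p, m => rounds p.run x m (m.var 0)

/-- The variables that are written, namely the loop variables. -/
def vars : LoopProg → List ℕ
  | .setArr _ _ _ _ => []
  | .seq p q => p.vars ++ q.vars
  | .when _ p => p.vars
  | .loop x p => x :: p.vars

/-- The arrays that are written. -/
def arrs : LoopProg → List ℕ
  | .setArr A _ _ _ => [A]
  | .seq p q => p.arrs ++ q.arrs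
  | .when _ p => p.arrs
  | .loop _ p => p.arrs

/-- No loop body changes the variable or the bound of its loop. -/
def wf : LoopProg → Bool
  | .setArr _ _ _ _ => true
  | .seq p q => p.wf && q.wf
  | .when _ p => p.wf
  | .loop x p => decide (x ≠ 0) && decide (x ∉ p.vars) && p.wf

/-- A bound on the number of steps, as a polynomial in the value of variable `0`. -/
noncomputable def stepBound : LoopProg → Polynomial ℕ
  | .setArr _ i j e => Polynomial.C (i.cost + j.cost + e.cost + 1)
  | .seq p q => p.stepBound + q.stepBound
  | .when e p => Polynomial.C (e.cost + 2) + p.stepBound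
  | .loop _ p => Polynomial.X * (p.stepBound + Polynomial.C 8) + Polynomial.C 6

/-- The memories `m` and `s` differ only in places that `p` may write. -/
structure Frame (p : LoopProg) (m s : Memory) : Prop where
  var : ∀ x, x ∉ p.vars → s.var x = m.var x
  arr : ∀ A, A ∉ p.arrs → s.arr A = m.arr A

theorem Frame.refl (p : LoopProg) (m : Memory) : Frame p m m := ⟨fun _ _ => rfl, fun _ _ => rfl⟩

theorem Frame.trans {p q r : LoopProg} {m s s' : Memory} (h : Frame p m s) (h' : Frame q s s')
    (hvar : p.vars ++ q.vars ⊆ r.vars) (harr : p.arrs ++ q.arrs ⊆ r.arrs) : Frame r m s' := by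
  simp only [List.append_subset] at hvar harr
  exact ⟨fun x hx => (h'.var x fun hq => hx (hvar.2 hq)).trans (h.var x fun hp => hx (hvar.1 hp)),
    fun A hA => (h'.arr A fun hq => hA (harr.2 hq)).trans (h.arr A fun hp => hA (harr.1 hp))⟩

theorem rounds_var_self (f : Memory → Memory) (x : ℕ) (m : Memory) (j : ℕ) :
    (rounds f x m j).var x = j := by
  cases j <;> simp [rounds, Memory.setVar]

theorem frame_rounds {p : LoopProg} (hp : ∀ m, Frame p m (p.run m)) (x : ℕ) (m : Memory) (j : ℕ) :
    Frame (loop x p) m (rounds p.run x m j) := by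
  have frame_setVar (s : Memory) (a : ℕ) : Frame (loop x p) s (s.setVar x a) :=
    ⟨fun y hy => if_neg fun h : y = x => hy (h ▸ List.mem_cons_self), fun _ _ => rfl⟩
  induction j with
  | zero => exact frame_setVar m 0
  | succ j ih =>
    exact (ih.trans (hp _) (r := loop x p) (by simp [vars]) (by simp [arrs])).trans
      (frame_setVar _ _) (by simp) (by simp)

theorem frame_run (p : LoopProg) (m : Memory) : Frame p m (p.run m) := by
  induction p generalizing m with
  | setArr A i j e =>
    refine ⟨fun _ _ => rfl, fun B hB => ?_⟩
    have hBA : B ≠ A := by simpa [arrs] using hB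
    simp [run, Memory.setArr, hBA]
  | seq p q hp hq => exact (hp m).trans (hq (p.run m)) (List.Subset.refl _) (List.Subset.refl _)
  | when e p hp =>
    simp only [run]
    split_ifs
    · exact ⟨(hp m).var, (hp m).arr⟩
    · exact .refl _ m
  | loop x p hp => exact frame_rounds hp x m _

theorem run_var {p : LoopProg} {x : ℕ} (hx : x ∉ p.vars) (m : Memory) :
    (p.run m).var x = m.var x :=
  (frame_run p m).var x hx

theorem run_arr {p : LoopProg} {A : ℕ} (hA : A ∉ p.arrs) (m : Memory) :
    (p.run m).arr A = m.arr A :=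
  (frame_run p m).arr A hA

theorem wf_loop_iff {x : ℕ} {p : LoopProg} :
    (loop x p).wf = true ↔ (x ≠ 0 ∧ x ∉ p.vars) ∧ p.wf = true := by
  simp [wf]

theorem zero_notMem_vars {p : LoopProg} (h : p.wf = true) : 0 ∉ p.vars := by
  induction p with
  | setArr A i j e => simp [vars]
  | seq p q hp hq =>
    simp only [wf, Bool.and_eq_true] at h
    simp [vars, hp h.1, hq h.2]
  | when e p hp => exact hp h
  | loop x p hp =>
    rw [wf_loop_iff] at h
    simp [vars, h.1.1.symm, hp h.2]

theorem exec_rounds {p : LoopProg} {x T d j : ℕ} {m : Memory} (hwf : (loop x p).wf = true)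
    (hp : ∀ s, s.var 0 = m.var 0 → ∃ t, Exec p.compile s (p.run s) t ∧ t ≤ T)
    (hj : j + d = m.var 0) :
    ∃ t, Exec (.loop (.sub (.var 0) (.var x))
        (.seq p.compile (.setVar x (.add (.var x) (.lit 1)))))
      (rounds p.run x m j) (rounds p.run x m (m.var 0)) t ∧ t ≤ d * (T + 8) + 4 := by
  have hzero (j : ℕ) : (rounds p.run x m j).var 0 = m.var 0 :=
    (frame_rounds (frame_run p) x m j).var 0 (zero_notMem_vars hwf)
  induction d generalizing j with
  | zero =>
    obtain rfl : j = m.var 0 := by omega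
    refine ⟨_, .loopEnd ?_, ?_⟩
    · simp [Expr.eval, rounds_var_self, hzero]
    · simp [Expr.cost]
  | succ d ih =>
    obtain ⟨t, ht, ht_le⟩ := ih (j := j + 1) (by omega)
    obtain ⟨s, hs, hs_le⟩ := hp (rounds p.run x m j) (hzero j)
    have increment := Exec.setVar (p.run (rounds p.run x m j)) x (.add (.var x) (.lit 1))
    have value : (Expr.add (.var x) (.lit 1)).eval (p.run (rounds p.run x m j)) = j + 1 := by
      simp [Expr.eval, run_var (wf_loop_iff.1 hwf).1.2, rounds_var_self]
    rw [value] at increment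
    refine ⟨_, .loopStep ?_ (.seq hs increment) ht, ?_⟩
    · simp only [Expr.eval, rounds_var_self, hzero]
      omega
    · simp only [Expr.cost, Nat.add_mul]
      omega

theorem exec_compile {p : LoopProg} (h : p.wf = true) (m : Memory) :
    ∃ t, Exec p.compile m (p.run m) t ∧ t ≤ p.stepBound.eval (m.var 0) := by
  induction p generalizing m with
  | setArr A i j e => exact ⟨_, .setArr m A i j e, by simp [stepBound]⟩
  | seq p q hp hq =>
    simp only [wf, Bool.and_eq_true] at h
    obtain ⟨s, hs, hs_le⟩ := hp h.1 m
    obtain ⟨t, ht, ht_le⟩ := hq h.2 (p.run m)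
    rw [run_var (zero_notMem_vars h.1)] at ht_le
    exact ⟨s + t, .seq hs ht, by simpa [stepBound] using add_le_add hs_le ht_le⟩
  | when e p hp =>
    by_cases he : e.Holds m
    · obtain ⟨t, ht, ht_le⟩ := hp h m
      rw [show (LoopProg.when e p).run m = p.run m from if_pos he]
      refine ⟨_, .condTrue he ht, ?_⟩
      simp only [stepBound, Polynomial.eval_add, Polynomial.eval_C]
      omega
    · rw [show (LoopProg.when e p).run m = m from if_neg he]
      refine ⟨_, .condFalse (not_not.1 he) (.skip m), ?_⟩
      simp only [stepBound, Polynomial.eval_add, Polynomial.eval_C]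
      omega
  | loop x p hp =>
    obtain ⟨t, ht, ht_le⟩ := exec_rounds (T := p.stepBound.eval (m.var 0)) (m := m) h
      (fun s hs => hs ▸ hp (wf_loop_iff.1 h).2 s) (zero_add _)
    refine ⟨_, .seq (.setVar m x (.lit 0)) ht, ?_⟩
    simp only [stepBound, Polynomial.eval_add, Polynomial.eval_C, Polynomial.eval_mul,
      Polynomial.eval_X, Expr.cost]
    omega

/-! ### Nested loops -/

theorem loop_induction {x : ℕ} {p : LoopProg} {m : Memory} {J : ℕ → (ℕ → ℕ → ℕ → ℕ) → Prop}
    (zero : J 0 m.arr)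
    (succ : ∀ j < m.var 0, ∀ s, s.var x = j → Frame (loop x p) m s → J j s.arr →
      J (j + 1) (p.run s).arr) :
    J (m.var 0) ((loop x p).run m).arr := by
  have key : ∀ j ≤ m.var 0, J j (rounds p.run x m j).arr := by
    intro j hj
    induction j with
    | zero => exact zero
    | succ j ih =>
      exact succ j hj _ (rounds_var_self _ x m j) (frame_rounds (frame_run p) x m j) (ih (by omega))
  exact key _ le_rfl

/-- Loops over the variables `xs`, each inside the preceding one. -/
def nest (xs : List ℕ) (p : LoopProg) : LoopProg := xs.foldr loop p

/-- A memory `s` in which the body of the nested loops `nest xs p`, started in `m`, may be run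
with the values `σ` of the loop variables. -/
structure Visit {n : ℕ} (xs : List ℕ) (p : LoopProg) (m s : Memory) (σ : ℕ → Fin n) : Prop
    extends Frame (nest xs p) m s where
  index : ∀ x ∈ xs, s.var x = σ x

theorem subset_nest_vars (xs : List ℕ) (p : LoopProg) : xs ⊆ (nest xs p).vars := by
  induction xs with
  | nil => simp
  | cons x xs ih => exact List.cons_subset_cons x ih

section Nest

variable {n x : ℕ} {xs : List ℕ} {p : LoopProg} {m s s' : Memory} {j : Fin n} {σ : ℕ → Fin n}

theorem Visit.cons (hwf : (nest (x :: xs) p).wf = true) (hs : s.var x = j)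
    (h : Frame (nest (x :: xs) p) m s) (h' : Visit xs p s s' σ) :
    Visit (x :: xs) p m s' (Function.update σ x j) := by
  have hx : x ∉ (nest xs p).vars := (wf_loop_iff.1 hwf).1.2
  refine ⟨h.trans h'.toFrame (by simp [nest, vars]) (by simp [nest, arrs]), fun y hy => ?_⟩
  rcases List.mem_cons.1 hy with rfl | hy
  · rw [h'.var _ hx, hs, Function.update_self]
  · have hyx : y ≠ x := fun e => hx (subset_nest_vars xs p (e ▸ hy))
    rw [Function.update_of_ne hyx, h'.index y hy]

variable [Nonempty (Fin n)] {J Q : (ℕ → ℕ → ℕ → ℕ) → Prop}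

theorem nest_invariant (hwf : (nest xs p).wf = true) (hn : m.var 0 = n)
    (hJ : ∀ s (σ : ℕ → Fin n), Visit xs p m s σ → J s.arr → J (p.run s).arr) (h : J m.arr) :
    J ((nest xs p).run m).arr := by
  induction xs generalizing m with
  | nil => exact hJ m (Classical.arbitrary _) ⟨.refl _ m, by simp⟩ h
  | cons x xs ih =>
    refine loop_induction (J := fun _ => J) h fun j hj s hsj hs hJs => ?_
    have hwf' := (wf_loop_iff.1 hwf).2
    refine ih hwf' (by rw [hs.var 0 (zero_notMem_vars hwf), hn]) (fun s' σ hs' => ?_) hJs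
    exact hJ s' _ (hs'.cons (j := ⟨j, hn ▸ hj⟩) hwf hsj hs)

theorem nest_hit (hwf : (nest xs p).wf = true) (hn : m.var 0 = n)
    (hJ : ∀ s (σ : ℕ → Fin n), Visit xs p m s σ → J s.arr → J (p.run s).arr)
    (hQ : ∀ s (σ : ℕ → Fin n), Visit xs p m s σ → J s.arr → Q s.arr → Q (p.run s).arr)
    (τ : ℕ → Fin n) (hτ : ∀ s, Visit xs p m s τ → J s.arr → Q (p.run s).arr) (h : J m.arr) :
    Q ((nest xs p).run m).arr := by
  induction xs generalizing m with
  | nil => exact hτ m ⟨.refl _ m, by simp⟩ h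
  | cons x xs ih =>
    have hwf' := (wf_loop_iff.1 hwf).2
    suffices J ((nest (x :: xs) p).run m).arr ∧
        ((τ x : ℕ) < m.var 0 → Q ((nest (x :: xs) p).run m).arr) from
      this.2 (hn ▸ (τ x).2)
    refine loop_induction (J := fun j a => J a ∧ ((τ x : ℕ) < j → Q a)) ⟨h, by simp⟩ ?_
    rintro j hj s hsj hs ⟨hJs, hQs⟩
    have hsn : s.var 0 = n := by rw [hs.var 0 (zero_notMem_vars hwf), hn]
    have visit {s' : Memory} {σ : ℕ → Fin n} (hs' : Visit xs p s s' σ) :=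
      hs'.cons (j := ⟨j, hn ▸ hj⟩) hwf hsj hs
    refine ⟨nest_invariant hwf' hsn (fun s' σ hs' => hJ s' _ (visit hs')) hJs, fun hlt => ?_⟩
    obtain hτj | rfl : (τ x : ℕ) < j ∨ (τ x : ℕ) = j := by omega
    · exact (nest_invariant (J := fun a => J a ∧ Q a) hwf' hsn (fun s' σ hs' h =>
        ⟨hJ s' _ (visit hs') h.1, hQ s' _ (visit hs') h.1 h.2⟩) ⟨hJs, hQs hτj⟩).2
    · refine ih hwf' hsn (fun s' σ hs' => hJ s' _ (visit hs')) (fun s' σ hs' => hQ s' _ (visit hs'))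
        (fun s' hs' => hτ s' ?_) hJs
      simpa using visit hs'

theorem nest_or {H : (ℕ → Fin n) → Prop} (hwf : (nest xs p).wf = true) (hn : m.var 0 = n)
    (hJ : ∀ s (σ : ℕ → Fin n), Visit xs p m s σ → J s.arr → J (p.run s).arr)
    (hQ : ∀ s (σ : ℕ → Fin n), Visit xs p m s σ → J s.arr → (Q (p.run s).arr ↔ Q s.arr ∨ H σ))
    (h : J m.arr) :
    Q ((nest xs p).run m).arr ↔ Q m.arr ∨ ∃ σ, H σ := by
  have keep (s : Memory) (σ : ℕ → Fin n) (hs : Visit xs p m s σ) (hJs : J s.arr) (hQs : Q s.arr) :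
      Q (p.run s).arr := (hQ s σ hs hJs).2 (.inl hQs)
  constructor
  · refine (nest_invariant (J := fun a => J a ∧ (Q a → Q m.arr ∨ ∃ σ, H σ)) hwf hn
      (fun s σ hs hJs => ⟨hJ s σ hs hJs.1, fun hQs => ?_⟩) ⟨h, .inl⟩).2
    exact ((hQ s σ hs hJs.1).1 hQs).elim hJs.2 fun hσ => .inr ⟨σ, hσ⟩
  · rintro (hQm | ⟨τ, hτ⟩)
    · exact (nest_invariant (J := fun a => J a ∧ Q a) hwf hn
        (fun s σ hs h => ⟨hJ s σ hs h.1, keep s σ hs h.1 h.2⟩) ⟨h, hQm⟩).2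
    · exact nest_hit hwf hn hJ keep τ (fun s hs hJs => (hQ s τ hs hJs).2 (.inr hτ)) h

end Nest

end LoopProg

/-! ### Conditions -/

namespace Expr

/-- Negation. -/
def not (e : Expr) : Expr := .sub (.lit 1) e

/-- Conjunction. -/
def and (e f : Expr) : Expr := (Expr.add e.not f.not).not

/-- Disjunction. -/
def or (e f : Expr) : Expr := .add e f

/-- Equality of values. -/
def eq (e f : Expr) : Expr := (Expr.add (.sub e f) (.sub f e)).not

/-- Comparison of values. -/
def le (e f : Expr) : Expr := (Expr.sub e f).not

/-- The truth value, `0` or `1`, of a condition. -/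
def bool (e : Expr) : Expr := e.not.not

/-- The minimum of two values. -/
def min (e f : Expr) : Expr := .sub e (.sub e f)

/-- The entry of the array `A` at the values of the variables `x` and `y`. -/
def entry (A x y : ℕ) : Expr := .arr A (.var x) (.var y)

variable (m : Memory) (e f : Expr)

@[simp] theorem holds_not : e.not.Holds m ↔ ¬ e.Holds m := by
  simp only [not, Holds, eval]; omega

@[simp] theorem holds_and : (e.and f).Holds m ↔ e.Holds m ∧ f.Holds m := by
  simp only [and, not, Holds, eval]; omega

@[simp] theorem holds_or : (e.or f).Holds m ↔ e.Holds m ∨ f.Holds m := by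
  simp only [or, Holds, eval]; omega

@[simp] theorem holds_eq : (e.eq f).Holds m ↔ e.eval m = f.eval m := by
  simp only [eq, not, Holds, eval]; omega

@[simp] theorem holds_le : (e.le f).Holds m ↔ e.eval m ≤ f.eval m := by
  simp only [le, not, Holds, eval]; omega

@[simp] theorem eval_bool : e.bool.eval m = if e.Holds m then 1 else 0 := by
  split_ifs with h <;> simp only [bool, not, Holds, eval] at h ⊢ <;> omega

@[simp] theorem eval_min : (e.min f).eval m = Nat.min (e.eval m) (f.eval m) := by
  simp only [min, eval, Nat.min_def]; split_ifs <;> omega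

end Expr

/-- The relation on nodes whose Boolean matrix an array holds. -/
def relOf {n : ℕ} (a : ℕ → ℕ → ℕ) (i j : Fin n) : Prop := a i j ≠ 0

theorem Expr.eval_entry {m : Memory} {A x y n : ℕ} {i j : Fin n} (hx : m.var x = i)
    (hy : m.var y = j) : (Expr.entry A x y).eval m = m.arr A i j := by
  simp only [entry, eval, hx, hy]

theorem Expr.holds_entry {m : Memory} {A x y n : ℕ} {i j : Fin n} (hx : m.var x = i)
    (hy : m.var y = j) : (Expr.entry A x y).Holds m ↔ relOf (m.arr A) i j := by
  rw [Holds, eval_entry hx hy, relOf]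

theorem Expr.holds_eq_var {m : Memory} {x y n : ℕ} {i j : Fin n} (hx : m.var x = i)
    (hy : m.var y = j) : (Expr.eq (.var x) (.var y)).Holds m ↔ i = j := by
  simp only [holds_eq, eval, hx, hy, Fin.val_inj]

/-! ### Filling, marking and transitive closure -/

namespace LoopProg

/-- Assign the value of `e`, as a function of the variables `x` and `y`, to the entries of the
array `A`. -/
def fill (A x y : ℕ) (e : Expr) : LoopProg := nest [x, y] (setArr A (.var x) (.var y) e)

/-- Mark the entries `(e, f)` of the array `A` for those values of the variables `xs` that satisfy
the condition `c`. -/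
def mark (xs : List ℕ) (c : Expr) (A : ℕ) (e f : Expr) : LoopProg :=
  nest xs (when c (setArr A e f (.lit 1)))

/-- One round of the Floyd–Warshall algorithm: allow the node in variable `8` as an inner node. -/
def closureRound (A : ℕ) : LoopProg :=
  mark [9, 10] (.and (.entry A 9 8) (.entry A 8 10)) A (.var 9) (.var 10)

/-- The Floyd–Warshall algorithm for the transitive closure of the relation in the array `A`. -/
def closure (A : ℕ) : LoopProg := loop 8 (closureRound A)

/-- Compute in the array `A` the transitive closure of the condition `c` on the nodes in the
variables `8` and `9`. -/
def transClosureOf (A : ℕ) (c : Expr) : LoopProg := seq (fill A 8 9 c) (closure A)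

variable {A n : ℕ} {m : Memory}

theorem fill_spec {x y : ℕ} {e : Expr} {i j : Fin n} {Q : ℕ → Prop}
    (hwf : (fill A x y e).wf = true) (hn : m.var 0 = n)
    (h : ∀ s, Frame (fill A x y e) m s → s.var x = i → s.var y = j → Q (e.eval s)) :
    Q (((fill A x y e).run m).arr A i j) := by
  have : Nonempty (Fin n) := ⟨i⟩
  have hxy : y ≠ x := fun hyx => (wf_loop_iff.1 hwf).1.2 (by simp [vars, hyx])
  refine nest_hit (J := fun _ => True) (Q := fun a => Q (a A i j)) hwf hn
    (fun _ _ _ _ => trivial) (fun s σ hs _ hQ => ?_) (fun z => if z = x then i else j)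
    (fun s hs _ => ?_) trivial
  · simp only [run, Memory.setArr, Expr.eval, true_and]
    split_ifs with hij
    · exact h s hs.toFrame hij.1.symm hij.2.symm
    · exact hQ
  · have hx : s.var x = i := by simpa using hs.index x (by simp)
    have hy : s.var y = j := by simpa [hxy] using hs.index y (by simp)
    simpa [run, Memory.setArr, Expr.eval, hx, hy] using h s hs.toFrame hx hy

theorem arr_run_when_setArr_one_ne_zero {c e f : Expr} {i j : ℕ} :
    ((when c (setArr A e f (.lit 1))).run m).arr A i j ≠ 0 ↔
      m.arr A i j ≠ 0 ∨ c.Holds m ∧ e.eval m = i ∧ f.eval m = j := by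
  simp only [run]
  split_ifs with hc
  · simp only [Memory.setArr, Expr.eval, true_and, hc]
    split_ifs with hij
    · simp [hij.1, hij.2]
    · grind
  · simp [hc]

theorem mark_spec [Nonempty (Fin n)] {xs : List ℕ} {c e f : Expr} {i j : ℕ}
    {P : (ℕ → Fin n) → Prop} {k l : (ℕ → Fin n) → ℕ} (hwf : (mark xs c A e f).wf = true)
    (hn : m.var 0 = n)
    (h : ∀ s (σ : ℕ → Fin n), Visit xs (when c (setArr A e f (.lit 1))) m s σ →
      (c.Holds s ↔ P σ) ∧ e.eval s = k σ ∧ f.eval s = l σ) :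
    ((mark xs c A e f).run m).arr A i j ≠ 0 ↔ m.arr A i j ≠ 0 ∨ ∃ σ, P σ ∧ k σ = i ∧ l σ = j := by
  refine nest_or (J := fun _ => True) (Q := fun a => a A i j ≠ 0) hwf hn
    (fun _ _ _ _ => trivial) (fun s σ hs _ => ?_) trivial
  obtain ⟨hc, he, hf⟩ := h s σ hs
  rw [arr_run_when_setArr_one_ne_zero, hc, he, hf]

theorem closureRound_spec {k : Fin n} (hn : m.var 0 = n) (hk : m.var 8 = k) (i j : Fin n) :
    relOf (((closureRound A).run m).arr A) i j ↔
      relOf (m.arr A) i j ∨ relOf (m.arr A) i k ∧ relOf (m.arr A) k j := by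
  have : Nonempty (Fin n) := ⟨k⟩
  set body := when (.and (.entry A 9 8) (.entry A 8 10)) (setArr A (.var 9) (.var 10) (.lit 1))
  have step (s : Memory) (σ : ℕ → Fin n) (hs : Visit [9, 10] body m s σ) (i j : Fin n) :
      relOf ((body.run s).arr A) i j ↔ relOf (s.arr A) i j ∨
        (relOf (s.arr A) (σ 9) k ∧ relOf (s.arr A) k (σ 10)) ∧ σ 9 = i ∧ σ 10 = j := by
    have h8 : s.var 8 = k := (hs.var 8 (by simp [body, nest, vars])).trans hk
    have h9 := hs.index 9 (by decide)
    have h10 := hs.index 10 (by decide)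
    rw [relOf, arr_run_when_setArr_one_ne_zero, Expr.holds_and, Expr.holds_entry h9 h8,
      Expr.holds_entry h8 h10, Expr.eval, Expr.eval, h9, h10, Fin.val_inj, Fin.val_inj]
    rfl
  refine (nest_or (J := fun a => ∀ i : Fin n, (relOf (a A) i k ↔ relOf (m.arr A) i k) ∧
      (relOf (a A) k i ↔ relOf (m.arr A) k i)) (Q := fun a => relOf (a A) i j)
    (H := fun σ => (relOf (m.arr A) (σ 9) k ∧ relOf (m.arr A) k (σ 10)) ∧ σ 9 = i ∧ σ 10 = j)
    rfl hn (fun s σ hs hJ x => ?_) (fun s σ hs hJ => ?_) fun _ => ⟨.rfl, .rfl⟩).trans ?_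
  · rw [step s σ hs, step s σ hs, ← (hJ x).1, ← (hJ x).2]
    grind
  · rw [step s σ hs, (hJ _).1, (hJ _).2]
  · refine or_congr_right ⟨?_, fun h => ⟨fun z => if z = 9 then i else j, by simpa using h⟩⟩
    rintro ⟨σ, h, rfl, rfl⟩
    exact h

/-- `i` and `j` are connected by a nonempty path all of whose inner nodes are smaller than `k`. -/
def ConnBelow (r : Fin n → Fin n → Prop) : ℕ → Fin n → Fin n → Prop
  | 0, i, j => r i j
  | k + 1, i, j => ConnBelow r k i j ∨
      ∃ h : k < n, ConnBelow r k i ⟨k, h⟩ ∧ ConnBelow r k ⟨k, h⟩ j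

section ConnBelow

variable {r : Fin n → Fin n → Prop} {k : ℕ} {i l j : Fin n}

theorem ConnBelow.of_rel (h : r i j) : ConnBelow r k i j := by
  induction k with
  | zero => exact h
  | succ k ih => exact .inl ih

theorem ConnBelow.transGen (h : ConnBelow r k i j) : Relation.TransGen r i j := by
  induction k generalizing i j with
  | zero => exact .single h
  | succ k ih =>
    rcases h with h | ⟨_, hik, hkj⟩
    · exact ih h
    · exact (ih hik).trans (ih hkj)

theorem ConnBelow.trans (hl : (l : ℕ) < k) (h : ConnBelow r k i l) (h' : ConnBelow r k l j) :
    ConnBelow r k i j := by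
  induction k generalizing i l j with
  | zero => omega
  | succ k ih =>
    obtain hlk | rfl : (l : ℕ) < k ∨ (l : ℕ) = k := by omega
    · rcases h with hil | ⟨hk, hik, hkl⟩ <;> rcases h' with hlj | ⟨_, hlk', hkj⟩
      · exact .inl (ih hlk hil hlj)
      · exact .inr ⟨by omega, ih hlk hil hlk', hkj⟩
      · exact .inr ⟨hk, hik, ih hlk hkl hlj⟩
      · exact .inr ⟨hk, hik, hkj⟩
    · have hil : ConnBelow r l i l := by
        rcases h with h | ⟨_, h, -⟩ <;> exact h
      have hlj : ConnBelow r l l j := by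
        rcases h' with h | ⟨_, -, h⟩ <;> exact h
      exact .inr ⟨l.2, hil, hlj⟩

theorem connBelow_eq_transGen : ConnBelow r n = Relation.TransGen r := by
  ext i j
  refine ⟨ConnBelow.transGen, fun h => ?_⟩
  induction h with
  | single h => exact .of_rel h
  | @tail l j _ hlj ih => exact ih.trans l.2 (.of_rel hlj)

end ConnBelow

theorem closure_spec (hn : m.var 0 = n) :
    (relOf (((closure A).run m).arr A) : Fin n → Fin n → Prop) =
      Relation.TransGen (relOf (m.arr A)) := by
  rw [← connBelow_eq_transGen]
  have main := loop_induction (x := 8) (p := closureRound A) (m := m)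
    (J := fun k a => ∀ i j : Fin n, relOf (a A) i j ↔ ConnBelow (relOf (m.arr A)) k i j)
    (fun _ _ => .rfl) fun k hk s hsk hs ih i j => ?_
  · rw [hn] at main
    exact funext₂ fun i j => propext (main i j)
  · rw [closureRound_spec (k := ⟨k, hn ▸ hk⟩)
      ((hs.var 0 (by simp [closureRound, mark, nest, vars])).trans hn) hsk, ih, ih, ih]
    exact or_congr_right ⟨fun h => ⟨hn ▸ hk, h⟩, fun ⟨_, h⟩ => h⟩

theorem transClosureOf_spec {c : Expr} {r : Fin n → Fin n → Prop} (hn : m.var 0 = n)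
    (h : ∀ s (i j : Fin n), Frame (fill A 8 9 c) m s → s.var 8 = i → s.var 9 = j →
      (c.Holds s ↔ r i j)) :
    (relOf (((transClosureOf A c).run m).arr A) : Fin n → Fin n → Prop) =
      Relation.TransGen r := by
  rw [transClosureOf, run, closure_spec ((run_var (by simp [fill, nest, vars]) m).trans hn)]
  congr
  ext i j
  exact fill_spec (Q := fun a => a ≠ 0 ↔ r i j) rfl hn (h · i j)

end LoopProg

open LoopProg

/-! ### The algorithm -/

-- The layout of the memory. The count of the colors and the answer stand at position `(0, 0)`, and
-- the marks of the colors that have been seen stand in column `0`. The variables `5` to `11` run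
-- over nodes: `5` stands for the color that is called, `7` for a node that is to be avoided, and
-- `8, 9, 10, 11` for the ends `u, d` of the territory before a move and `u', d'` after it.
abbrev startVar : ℕ := 2
abbrev boundVar : ℕ := 3
abbrev adjArr : ℕ := 0
abbrev colorArr : ℕ := 1
abbrev blockArr : ℕ := 2
abbrev touchArr : ℕ := 3
abbrev costArr : ℕ := 4
abbrev avoidableArr : ℕ := 5
abbrev avoidingArr : ℕ := 6
abbrev seenArr : ℕ := 7
abbrev countArr : ℕ := 8
abbrev answerArr : ℕ := 9

/-- The color of the node in the variable `x`. -/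
def colorOf (x : ℕ) : Expr := .arr colorArr (.var x) (.lit 0)

/-- The nodes in the variables `x` and `y` have the same color. -/
def sameColor (x y : ℕ) : Expr := .eq (colorOf x) (colorOf y)

/-- The node in the variable `x` is not the start node. -/
def notStart (x : ℕ) : Expr := (Expr.eq (.var x) (.var startVar)).not

/-- The number of colors that have been counted. -/
def colorCount : Expr := .arr countArr (.lit 0) (.lit 0)

/-- Compute the relation of being in the same block. -/
def computeBlocks : LoopProg :=
  transClosureOf blockArr (.or (.eq (.var 8) (.var 9))
    (.and (.entry adjArr 8 9) (.and (sameColor 8 9) (.and (notStart 8) (notStart 9)))))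

/-- Compute the touching relation from the blocks. -/
def computeTouch : LoopProg :=
  mark [4, 5, 6, 7] (.and (.entry blockArr 4 5)
    (.and (.or (.eq (.var 5) (.var 6)) (.entry adjArr 5 6)) (.entry blockArr 6 7)))
    touchArr (.var 4) (.var 7)

/-- Count the color of the node in variable `4`, unless it has been seen before. -/
def countColor : LoopProg :=
  seq (when (Expr.not (.arr seenArr (colorOf 4) (.lit 0)))
      (setArr countArr (.lit 0) (.lit 0) (.add colorCount (.lit 1))))
    (setArr seenArr (colorOf 4) (.lit 0) (.lit 1))

/-- Count the colors of the nodes other than the start node. -/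
def countColors : LoopProg := loop 4 (when (notStart 4) countColor)

/-- Set the initial costs: `0` for the pair formed by the start node, at which both ends are before
the first move, and more than the bound for all other pairs. -/
def initCosts : LoopProg :=
  seq (fill costArr 4 5 (.add (.var boundVar) (.lit 1)))
    (setArr costArr (.var startVar) (.var startVar) (.lit 0))

/-- Mark the pairs that are linked avoiding the node in variable `7`. -/
def markLinkedAvoiding : LoopProg :=
  seq (transClosureOf avoidingArr (.and (.entry touchArr 8 9)
      (.and (.not (.entry touchArr 7 8)) (.not (.entry touchArr 7 9)))))
    (mark [8, 9] (.entry avoidingArr 8 9) avoidableArr (.var 8) (.var 9))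

/-- Compute the pairs that are linked avoiding some node with property `e`. -/
def computeAvoidable (e : Expr) : LoopProg :=
  seq (fill avoidableArr 8 9 (.lit 0)) (nest [7] (when e markLinkedAvoiding))

/-- The end in variable `x` may move to the node in variable `y`. -/
def canMove (x y : ℕ) : Expr :=
  .or (.eq (.var y) (.var x)) (.and (.entry touchArr x y) (.and (notStart y) (sameColor y 5)))

/-- The cost of reaching the current ends and making one more move. -/
def costAfterMove : Expr := .add (.entry costArr 8 9) (.bool (.entry avoidableArr 8 9))

/-- Improve the cost of one pair of ends by one move. -/
def relaxPair : LoopProg :=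
  when (.and (canMove 8 10) (canMove 9 11))
    (setArr costArr (.var 10) (.var 11) (.min (.entry costArr 10 11) costAfterMove))

/-- Improve all costs by one move with the color of the node in variable `5`. -/
def relaxColor : LoopProg :=
  when (notStart 5) (seq (computeAvoidable (.and (notStart 7) (sameColor 7 5)))
    (nest [8, 9, 10, 11] relaxPair))

/-- The Bellman–Ford algorithm on the pairs of ends. -/
def computeCosts : LoopProg := loop 4 (nest [5] relaxColor)

/-- Compare the costs of the pairs that form a goal with the bound. -/
def computeAnswer : LoopProg :=
  mark [4, 5] (.and (.not (.entry avoidableArr 4 5))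
    (.le (.add (.entry costArr 4 5) colorCount) (.var boundVar))) answerArr (.lit 0) (.lit 0)

/-- The answer of the algorithm is YES. -/
def answer : Expr := .arr answerArr (.lit 0) (.lit 0)

/-- The preparation of the shortest path search. -/
def prepare : LoopProg := seq computeBlocks (seq computeTouch (seq countColors initCosts))

/-- The algorithm up to the output of the answer. -/
def solver : LoopProg :=
  seq prepare (seq computeCosts (seq (computeAvoidable (.lit 1)) computeAnswer))

/-! ### The input and the touching relation in the memory -/

instance (I : Instance) : Nonempty (Fin I.n) := ⟨I.start⟩

/-- The touching relation on the nodes of an instance. -/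
abbrev Instance.touch (I : Instance) : Fin I.n → Fin I.n → Prop := Touch I.graph I.col I.start

/-- The program overwrites no part of the input. -/
def LoopProg.keepsInput (p : LoopProg) : Bool :=
  decide ((0 ∉ p.vars ∧ startVar ∉ p.vars ∧ boundVar ∉ p.vars) ∧
    adjArr ∉ p.arrs ∧ colorArr ∉ p.arrs)

/-- The program overwrites neither the input nor the touching relation. -/
def LoopProg.keepsTouch (p : LoopProg) : Bool := p.keepsInput && decide (touchArr ∉ p.arrs)

/-- The memory holds the input. -/
structure HoldsInput (I : Instance) (m : Memory) : Prop where
  nodes : m.var 0 = I.n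
  start : m.var startVar = I.start
  bound : m.var boundVar = I.bound
  adj : relOf (m.arr adjArr) = I.graph.Adj
  color : ∀ i : Fin I.n, m.arr colorArr i 0 = I.col i

/-- The memory holds the input and the touching relation. -/
structure HoldsTouch (I : Instance) (m : Memory) : Prop extends HoldsInput I m where
  touch : relOf (m.arr touchArr) = I.touch

section Memory

variable {I : Instance} {m s : Memory} {p : LoopProg} {x y : ℕ} {i j : Fin I.n}

theorem holdsInput_memory (I : Instance) : HoldsInput I I.memory where
  nodes := rfl
  start := rfl
  bound := rfl
  adj := by ext i j; simp [relOf, Instance.memory]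
  color i := by simp [Instance.memory]

theorem HoldsInput.frame (h : HoldsInput I m) (hs : Frame p m s) (hp : p.keepsInput = true) :
    HoldsInput I s := by
  obtain ⟨⟨h0, h2, h3⟩, hadj, hcolor⟩ := of_decide_eq_true hp
  exact ⟨hs.var _ h0 ▸ h.nodes, hs.var _ h2 ▸ h.start, hs.var _ h3 ▸ h.bound,
    hs.arr _ hadj ▸ h.adj, hs.arr _ hcolor ▸ h.color⟩

theorem HoldsTouch.frame (h : HoldsTouch I m) (hs : Frame p m s) (hp : p.keepsTouch = true) :
    HoldsTouch I s := by
  simp only [keepsTouch, Bool.and_eq_true, decide_eq_true_eq] at hp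
  exact ⟨h.toHoldsInput.frame hs hp.1, hs.arr _ hp.2 ▸ h.touch⟩

theorem HoldsInput.run (h : HoldsInput I m) (hp : p.keepsInput = true) : HoldsInput I (p.run m) :=
  h.frame (frame_run p m) hp

theorem HoldsTouch.run (h : HoldsTouch I m) (hp : p.keepsTouch = true) : HoldsTouch I (p.run m) :=
  h.frame (frame_run p m) hp

theorem HoldsInput.eval_colorOf (h : HoldsInput I m) (hx : m.var x = i) :
    (colorOf x).eval m = I.col i := by
  simp only [colorOf, Expr.eval, hx, h.color]

theorem HoldsInput.holds_sameColor (h : HoldsInput I m) (hx : m.var x = i) (hy : m.var y = j) :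
    (sameColor x y).Holds m ↔ I.col i = I.col j := by
  rw [sameColor, Expr.holds_eq, h.eval_colorOf hx, h.eval_colorOf hy, Fin.val_inj]

theorem HoldsInput.holds_notStart (h : HoldsInput I m) (hx : m.var x = i) :
    (notStart x).Holds m ↔ i ≠ I.start := by
  rw [notStart, Expr.holds_not, Expr.holds_eq_var hx h.start]

theorem HoldsInput.holds_entry_adj (h : HoldsInput I m) (hx : m.var x = i) (hy : m.var y = j) :
    (Expr.entry adjArr x y).Holds m ↔ I.graph.Adj i j := by
  rw [Expr.holds_entry hx hy, h.adj]

theorem HoldsTouch.holds_entry_touch (h : HoldsTouch I m) (hx : m.var x = i) (hy : m.var y = j) :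
    (Expr.entry touchArr x y).Holds m ↔ I.touch i j := by
  rw [Expr.holds_entry hx hy, h.touch]

end Memory

/-! ### Correctness of the preparation -/

section Preparation

variable {I : Instance} {m : Memory}

theorem computeBlocks_spec (h : HoldsInput I m) :
    relOf ((computeBlocks.run m).arr blockArr) = SameBlock I.graph I.col I.start := by
  rw [computeBlocks, transClosureOf_spec h.nodes
    (r := Relation.ReflGen (blockGraph I.graph I.col I.start).Adj), Relation.transGen_reflGen]
  · ext i j
    rw [SameBlock, SimpleGraph.reachable_iff_reflTransGen]
  · intro s i j hs h8 h9
    have hI := h.frame hs rfl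
    rw [Expr.holds_or, Expr.holds_and, Expr.holds_and, Expr.holds_and, Expr.holds_eq_var h8 h9,
      hI.holds_entry_adj h8 h9, hI.holds_sameColor h8 h9, hI.holds_notStart h8,
      hI.holds_notStart h9, Relation.reflGen_iff, eq_comm]
    rfl

theorem computeTouch_spec (h : HoldsInput I m)
    (hblock : relOf (m.arr blockArr) = SameBlock I.graph I.col I.start)
    (hzero : m.arr touchArr = 0) : relOf ((computeTouch.run m).arr touchArr) = I.touch := by
  ext i j
  rw [relOf, computeTouch, mark_spec (k := fun σ => σ 4) (l := fun σ => σ 7)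
    (P := fun σ : ℕ → Fin I.n => SameBlock I.graph I.col I.start (σ 4) (σ 5) ∧
      (σ 5 = σ 6 ∨ I.graph.Adj (σ 5) (σ 6)) ∧ SameBlock I.graph I.col I.start (σ 6) (σ 7))
    rfl h.nodes]
  · simp only [hzero, Pi.zero_apply, ne_eq, not_true_eq_false, false_or, Fin.val_inj]
    constructor
    · rintro ⟨σ, hσ, rfl, rfl⟩
      exact ⟨σ 5, σ 6, hσ⟩
    · rintro ⟨x, y, hxy⟩
      exact ⟨fun z => if z = 4 then i else if z = 5 then x else if z = 6 then y else j,
        by simpa using hxy, by simp, by simp⟩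
  · intro s σ hs
    have hI := h.frame hs.toFrame rfl
    have h4 := hs.index 4 (by decide)
    have h5 := hs.index 5 (by decide)
    have h6 := hs.index 6 (by decide)
    have h7 := hs.index 7 (by decide)
    rw [Expr.holds_and, Expr.holds_and, Expr.holds_or, Expr.holds_entry h4 h5,
      Expr.holds_entry h6 h7, Expr.holds_eq_var h5 h6, hI.holds_entry_adj h5 h6,
      hs.arr blockArr (by decide), hblock]
    exact ⟨.rfl, h4, h7⟩

/-- The array of marks represents the set `S` of colors, and the count is its size. -/
structure Counted {k : ℕ} (S : Finset (Fin k)) (a : ℕ → ℕ → ℕ → ℕ) : Prop where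
  mem : ∀ c : Fin k, a seenArr c 0 ≠ 0 ↔ c ∈ S
  card : a countArr 0 0 = S.card

theorem countColor_spec {S : Finset (Fin I.k)} {i : Fin I.n} (h : HoldsInput I m)
    (hi : m.var 4 = i) (hS : Counted S m.arr) :
    Counted (insert (I.col i) S) (countColor.run m).arr := by
  have hseen : (Expr.arr seenArr (colorOf 4) (.lit 0)).Holds m ↔ I.col i ∈ S := by
    rw [Expr.Holds, Expr.eval, h.eval_colorOf hi, Expr.eval, hS.mem]
  set m' := (when (Expr.not (.arr seenArr (colorOf 4) (.lit 0)))
    (setArr countArr (.lit 0) (.lit 0) (.add colorCount (.lit 1)))).run m with hm'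
  have hrun : (countColor.run m).arr = (m'.setArr seenArr (I.col i) 0 1).arr := by
    rw [← (h.run (p := when _ _) rfl : HoldsInput I m').eval_colorOf
      ((run_var (p := when _ _) (by decide) m).trans hi)]
    rfl
  rw [hrun]
  constructor
  · intro c
    have hkeep : m'.arr seenArr = m.arr seenArr := run_arr (p := when _ _) (by decide) m
    simp only [Memory.setArr, true_and, and_true, Fin.val_inj, hkeep, Finset.mem_insert, ← hS.mem]
    split_ifs with hc <;> simp [hc]
  · have hcount : m'.arr countArr 0 0 = if I.col i ∈ S then S.card else S.card + 1 := by
      simp only [hm', run, Expr.holds_not, hseen, ite_not]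
      split_ifs
      · exact hS.card
      · simp [Memory.setArr, Expr.eval, colorCount, hS.card]
    rw [Finset.card_insert_eq_ite, ← hcount]
    simp [Memory.setArr]

/-- The colors of the nodes smaller than `j`, other than the start node. -/
def colorsBelow (I : Instance) (j : ℕ) : Finset (Fin I.k) :=
  {x : Fin I.n | x ≠ I.start ∧ (x : ℕ) < j}.toFinset.image I.col

theorem mem_colorsBelow {j : ℕ} {c : Fin I.k} :
    c ∈ colorsBelow I j ↔ ∃ x, (x ≠ I.start ∧ (x : ℕ) < j) ∧ I.col x = c := by
  simp [colorsBelow]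

theorem colorsBelow_succ (j : Fin I.n) : colorsBelow I (j + 1) =
    if j = I.start then colorsBelow I j else insert (I.col j) (colorsBelow I j) := by
  ext c
  split_ifs with hj <;> simp only [Finset.mem_insert, mem_colorsBelow] <;> grind

theorem colorsBelow_n (I : Instance) : colorsBelow I I.n = colors I.col I.start := by
  ext c
  simp [mem_colorsBelow, mem_colors, colorClass, Set.Nonempty]

theorem countColors_spec (h : HoldsInput I m) (hseen : m.arr seenArr = 0)
    (hcount : m.arr countArr = 0) :
    (countColors.run m).arr countArr 0 0 = (colors I.col I.start).card := by
  rw [← colorsBelow_n, ← h.nodes]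
  refine (loop_induction (x := 4) (p := when (notStart 4) countColor)
    (J := fun j a => Counted (colorsBelow I j) a)
    (by constructor <;> simp [colorsBelow, hseen, hcount]) fun j hj s hsj hs hJ => ?_).card
  lift j to Fin I.n using h.nodes ▸ hj
  have hI := h.frame hs rfl
  simp only [run, hI.holds_notStart hsj, ite_not, colorsBelow_succ]
  split_ifs
  · exact hJ
  · exact countColor_spec hI hsj hJ

end Preparation

/-! ### Correctness of the shortest path search -/

section ShortestPath

variable {I : Instance} {m : Memory}

/-- The costs not above the bound belong to sequences of moves. -/
def Attained (I : Instance) (a : ℕ → ℕ → ℕ) : Prop :=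
  ∀ u d : Fin I.n, a u d ≤ I.bound →
    ∃ r N, MoveSeq I.touch I.col I.start r N u d ∧ N ≤ a u d

/-- The costs do not exceed those of the sequences of at most `k` moves. -/
def BelowCosts (I : Instance) (k : ℕ) (a : ℕ → ℕ → ℕ) : Prop :=
  ∀ r ≤ k, ∀ N, ∀ u d : Fin I.n, MoveSeq I.touch I.col I.start r N u d → a u d ≤ N

/-- The costs `a'` improve the costs `a` and remain attained. -/
structure Relaxes (I : Instance) (a a' : ℕ → ℕ → ℕ) : Prop where
  le : ∀ u d : Fin I.n, a' u d ≤ a u d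
  attained : Attained I a → Attained I a'

theorem Relaxes.refl (a : ℕ → ℕ → ℕ) : Relaxes I a a := ⟨fun _ _ => le_rfl, id⟩

theorem Relaxes.trans {a a' a'' : ℕ → ℕ → ℕ} (h : Relaxes I a a') (h' : Relaxes I a' a'') :
    Relaxes I a a'' :=
  ⟨fun u d => (h'.le u d).trans (h.le u d), h'.attained ∘ h.attained⟩

/-- The costs `a'` are at most those that arise from `a` by one more move with the color `c`. -/
def BelowMoves (I : Instance) (c : Fin I.k) (a a' : ℕ → ℕ → ℕ) : Prop :=
  ∀ u d u' d', Move I.touch I.col I.start c u u' → Move I.touch I.col I.start c d d' →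
    a' u' d' ≤ a u d + moveCost I.touch I.col I.start c u d

/-- The memory holds the pairs of ends for which a move with the color `c` is not free. -/
def HoldsAvoidable (I : Instance) (c : Fin I.k) (m : Memory) : Prop :=
  ∀ u d : Fin I.n, relOf (m.arr avoidableArr) u d ↔
    ∃ x ∈ colorClass I.col I.start c, LinkedAvoiding I.touch x u d

theorem initCosts_spec (h : HoldsInput I m) :
    Attained I ((initCosts.run m).arr costArr) ∧
      BelowCosts I 0 ((initCosts.run m).arr costArr) := by
  have hcost (u d : Fin I.n) : (initCosts.run m).arr costArr u d =
      if u = I.start ∧ d = I.start then 0 else I.bound + 1 := by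
    have hfill : ((fill costArr 4 5 (.add (.var boundVar) (.lit 1))).run m).arr costArr u d =
        I.bound + 1 :=
      fill_spec (Q := (· = I.bound + 1)) rfl h.nodes fun s hs _ _ => by
        rw [Expr.eval, Expr.eval, Expr.eval, (h.frame hs rfl).bound]
    have hstart := (h.run (p := fill costArr 4 5 (.add (.var boundVar) (.lit 1))) rfl).start
    simp only [initCosts, run, Memory.setArr, Expr.eval, true_and, hstart, Fin.val_inj, hfill]
  constructor
  · intro u d hud
    rw [hcost] at hud ⊢
    split_ifs at hud ⊢ with hstart
    · obtain ⟨rfl, rfl⟩ := hstart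
      exact ⟨0, 0, .nil, le_rfl⟩
    · omega
  · intro r hr N u d hseq
    cases hseq with
    | nil => simp [hcost]
    | step => omega

theorem markLinkedAvoiding_spec (h : HoldsTouch I m) {x : Fin I.n} (hx : m.var 7 = x)
    (u d : Fin I.n) : relOf ((markLinkedAvoiding.run m).arr avoidableArr) u d ↔
      relOf (m.arr avoidableArr) u d ∨ LinkedAvoiding I.touch x u d := by
  set c : Expr := .and (.entry touchArr 8 9)
    (.and (.not (.entry touchArr 7 8)) (.not (.entry touchArr 7 9)))
  have hclosure : relOf (((transClosureOf avoidingArr c).run m).arr avoidingArr) =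
      LinkedAvoiding I.touch x := by
    refine transClosureOf_spec h.nodes fun s i j hs h8 h9 => ?_
    have hT := h.frame hs rfl
    have h7 : s.var 7 = x := (hs.var 7 (by decide)).trans hx
    rw [Expr.holds_and, Expr.holds_and, Expr.holds_not, Expr.holds_not,
      hT.holds_entry_touch h8 h9, hT.holds_entry_touch h7 h8, hT.holds_entry_touch h7 h9]
    rfl
  rw [relOf, markLinkedAvoiding, run, mark_spec (k := fun σ => σ 8) (l := fun σ => σ 9)
    (P := fun σ : ℕ → Fin I.n => LinkedAvoiding I.touch x (σ 8) (σ 9)) rfl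
    (h.run (p := transClosureOf avoidingArr c) rfl).nodes,
    run_arr (p := transClosureOf avoidingArr c) (by decide)]
  · refine or_congr_right ⟨?_, fun hud => ⟨fun z => if z = 8 then u else d, by simpa using hud⟩⟩
    rintro ⟨σ, hσ, hu, hd⟩
    rwa [Fin.ext hu, Fin.ext hd] at hσ
  · intro s σ hs
    have h8 := hs.index 8 (by decide)
    have h9 := hs.index 9 (by decide)
    rw [Expr.holds_entry h8 h9, hs.arr avoidingArr (by decide), hclosure]
    exact ⟨.rfl, h8, h9⟩

theorem computeAvoidable_spec (h : HoldsTouch I m) {e : Expr} {P : Fin I.n → Prop}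
    (he : ∀ s (x : Fin I.n), Frame (computeAvoidable e) m s → s.var 7 = x → (e.Holds s ↔ P x))
    (u d : Fin I.n) : relOf (((computeAvoidable e).run m).arr avoidableArr) u d ↔
      ∃ x, P x ∧ LinkedAvoiding I.touch x u d := by
  set m' := (fill avoidableArr 8 9 (.lit 0)).run m
  have hzero : ¬ relOf (m'.arr avoidableArr) u d :=
    fill_spec (Q := fun a => ¬ a ≠ 0) rfl h.nodes fun _ _ _ _ => by simp [Expr.eval]
  have hT : HoldsTouch I m' := h.run rfl
  rw [computeAvoidable, run, relOf, nest_or (J := fun _ => True)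
    (Q := fun a => a avoidableArr u d ≠ 0)
    (H := fun σ : ℕ → Fin I.n => P (σ 7) ∧ LinkedAvoiding I.touch (σ 7) u d) rfl hT.nodes
    (fun _ _ _ _ => trivial) (fun s σ hs _ => ?_) trivial]
  · refine (or_iff_right hzero).trans ?_
    exact ⟨fun ⟨σ, hσ⟩ => ⟨σ 7, hσ⟩, fun ⟨x, hx⟩ => ⟨fun _ => x, hx⟩⟩
  · have h7 := hs.index 7 (by decide)
    have hs' : Frame (computeAvoidable e) m s := (frame_run _ m).trans hs.toFrame
      (List.Subset.refl _) (List.Subset.refl _)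
    have he' := he s (σ 7) hs' h7
    simp only [run]
    split_ifs with hP
    · exact (markLinkedAvoiding_spec (hT.frame hs.toFrame rfl) h7 u d).trans
        (or_congr_right (and_iff_right (he'.1 hP)).symm)
    · exact (or_iff_left fun h => hP (he'.2 h.1)).symm

theorem HoldsTouch.holds_canMove (h : HoldsTouch I m) {x y : ℕ} {z u u' : Fin I.n}
    (hz : m.var 5 = z) (hx : m.var x = u) (hy : m.var y = u') :
    (canMove x y).Holds m ↔ Move I.touch I.col I.start (I.col z) u u' := by
  rw [canMove, Expr.holds_or, Expr.holds_and, Expr.holds_and, Expr.holds_eq_var hy hx,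
    h.holds_entry_touch hx hy, h.holds_notStart hy, h.holds_sameColor hy hz]
  rfl

theorem eval_costAfterMove {c : Fin I.k} {u d : Fin I.n} (hu : m.var 8 = u) (hd : m.var 9 = d)
    (havoid : HoldsAvoidable I c m) : costAfterMove.eval m =
      m.arr costArr u d + moveCost I.touch I.col I.start c u d := by
  rw [costAfterMove, Expr.eval, Expr.eval_bool, Expr.eval_entry hu hd, moveCost]
  have hiff := (Expr.holds_entry hu hd).trans (havoid u d)
  split_ifs with hholds hlinked hlinked
  · rfl
  · exact absurd (hiff.1 hholds) hlinked
  · exact absurd (hiff.2 hlinked) hholds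
  · rfl

theorem relaxes_of_eq_ite {a a' : ℕ → ℕ → ℕ} {c : Fin I.k} {u d u' d' : Fin I.n}
    (hc : (colorClass I.col I.start c).Nonempty) (hu : Move I.touch I.col I.start c u u')
    (hd : Move I.touch I.col I.start c d d')
    (ha' : ∀ i j : Fin I.n, a' i j = if i = u' ∧ j = d' then
      min (a u' d') (a u d + moveCost I.touch I.col I.start c u d) else a i j) :
    Relaxes I a a' := by
  constructor
  · intro i j
    rw [ha']
    split_ifs with hij
    · exact hij.1 ▸ hij.2 ▸ min_le_left _ _
    · exact le_rfl
  · intro h i j hle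
    rw [ha'] at hle ⊢
    split_ifs at hle ⊢ with hij
    · obtain ⟨rfl, rfl⟩ := hij
      rcases min_choice (a i j) (a u d + moveCost I.touch I.col I.start c u d) with hmin | hmin
      · rw [hmin] at hle ⊢
        exact h i j hle
      · rw [hmin] at hle ⊢
        obtain ⟨r, N, hseq, hN⟩ := h u d (by omega)
        exact ⟨r + 1, _, .step hseq hc hu hd, by omega⟩
    · exact h i j hle

theorem relaxPair_spec (h : HoldsTouch I m) {z u d u' d' : Fin I.n} (hz : m.var 5 = z)
    (hu : m.var 8 = u) (hd : m.var 9 = d) (hu' : m.var 10 = u') (hd' : m.var 11 = d')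
    (hstart : z ≠ I.start) (havoid : HoldsAvoidable I (I.col z) m) :
    Relaxes I (m.arr costArr) ((relaxPair.run m).arr costArr) ∧
      (Move I.touch I.col I.start (I.col z) u u' → Move I.touch I.col I.start (I.col z) d d' →
        (relaxPair.run m).arr costArr u' d' ≤
          m.arr costArr u d + moveCost I.touch I.col I.start (I.col z) u d) := by
  have hcond : (Expr.and (canMove 8 10) (canMove 9 11)).Holds m ↔
      Move I.touch I.col I.start (I.col z) u u' ∧ Move I.touch I.col I.start (I.col z) d d' := by
    rw [Expr.holds_and, h.holds_canMove hz hu hu', h.holds_canMove hz hd hd']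
  simp only [relaxPair, run]
  split_ifs with hmove
  · rw [hcond] at hmove
    have hrun (i j : Fin I.n) : (m.setArr costArr ((Expr.var 10).eval m) ((Expr.var 11).eval m)
        ((Expr.min (.entry costArr 10 11) costAfterMove).eval m)).arr costArr i j =
        if i = u' ∧ j = d' then min (m.arr costArr u' d')
          (m.arr costArr u d + moveCost I.touch I.col I.start (I.col z) u d)
        else m.arr costArr i j := by
      simp only [Memory.setArr, Expr.eval, Expr.eval_min, Expr.eval_entry hu' hd', hu', hd',
        eval_costAfterMove hu hd havoid, true_and, Fin.val_inj]
    refine ⟨relaxes_of_eq_ite ⟨z, hstart, rfl⟩ hmove.1 hmove.2 hrun, fun _ _ => ?_⟩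
    rw [hrun, if_pos ⟨rfl, rfl⟩]
    exact min_le_right _ _
  · exact ⟨.refl _, fun hmu hmd => absurd (hcond.2 ⟨hmu, hmd⟩) hmove⟩

theorem nest_relaxPair_spec (h : HoldsTouch I m) {z : Fin I.n} (hz : m.var 5 = z)
    (hstart : z ≠ I.start) (havoid : HoldsAvoidable I (I.col z) m) :
    Relaxes I (m.arr costArr) (((nest [8, 9, 10, 11] relaxPair).run m).arr costArr) ∧
      BelowMoves I (I.col z) (m.arr costArr)
        (((nest [8, 9, 10, 11] relaxPair).run m).arr costArr) := by
  have step (s : Memory) (σ : ℕ → Fin I.n) (hs : Visit [8, 9, 10, 11] relaxPair m s σ) :=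
    relaxPair_spec (h.frame hs.toFrame rfl) ((hs.var 5 (by decide)).trans hz)
      (hs.index 8 (by decide)) (hs.index 9 (by decide)) (hs.index 10 (by decide))
      (hs.index 11 (by decide)) hstart (by
        rw [HoldsAvoidable, hs.arr avoidableArr (by decide)]; exact havoid)
  have relaxes (s : Memory) (σ : ℕ → Fin I.n) (hs : Visit [8, 9, 10, 11] relaxPair m s σ)
      (hJ : Relaxes I (m.arr costArr) (s.arr costArr)) :
      Relaxes I (m.arr costArr) ((relaxPair.run s).arr costArr) := hJ.trans (step s σ hs).1
  refine ⟨nest_invariant (J := fun a => Relaxes I (m.arr costArr) (a costArr)) rfl h.nodes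
    relaxes (.refl _), fun u d u' d' hu hd => ?_⟩
  refine nest_hit (J := fun a => Relaxes I (m.arr costArr) (a costArr))
    (Q := fun a => a costArr u' d' ≤
      m.arr costArr u d + moveCost I.touch I.col I.start (I.col z) u d) rfl h.nodes relaxes
    (fun s σ hs _ hQ => ((step s σ hs).1.le u' d').trans hQ)
    (fun x => if x = 8 then u else if x = 9 then d else if x = 10 then u' else d')
    (fun s hs hJ => ?_) (.refl _)
  exact ((step s _ hs).2 (by simpa using hu) (by simpa using hd)).trans
    (Nat.add_le_add_right (hJ.le u d) _)

theorem relaxColor_spec (h : HoldsTouch I m) {z : Fin I.n} (hz : m.var 5 = z) :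
    Relaxes I (m.arr costArr) ((relaxColor.run m).arr costArr) ∧
      (z ≠ I.start →
        BelowMoves I (I.col z) (m.arr costArr) ((relaxColor.run m).arr costArr)) := by
  simp only [relaxColor, run, h.holds_notStart hz]
  split_ifs with hstart
  · set p := computeAvoidable (.and (notStart 7) (sameColor 7 5))
    have havoid : HoldsAvoidable I (I.col z) (p.run m) :=
      computeAvoidable_spec h fun s x hs h7 => by
        have hI := h.frame hs rfl
        rw [Expr.holds_and, hI.holds_notStart h7,
          hI.holds_sameColor h7 ((hs.var 5 (by decide)).trans hz)]
        rfl
    have hrelax := nest_relaxPair_spec (h.run (p := p) rfl)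
      ((run_var (p := p) (by decide) m).trans hz) hstart havoid
    rw [run_arr (p := p) (by decide)] at hrelax
    exact ⟨hrelax.1, fun _ => hrelax.2⟩
  · exact ⟨.refl _, fun h => absurd h hstart⟩

theorem BelowCosts.of_relaxes {k : ℕ} {a a' : ℕ → ℕ → ℕ} (h : BelowCosts I k a)
    (ha : Relaxes I a a') : BelowCosts I k a' :=
  fun r hr N u d hseq => (ha.le u d).trans (h r hr N u d hseq)

theorem nest_relaxColor_spec (h : HoldsTouch I m) {k : ℕ} (hcost : BelowCosts I k (m.arr costArr)) :
    Relaxes I (m.arr costArr) (((nest [5] relaxColor).run m).arr costArr) ∧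
      BelowCosts I (k + 1) (((nest [5] relaxColor).run m).arr costArr) := by
  have step (s : Memory) (σ : ℕ → Fin I.n) (hs : Visit [5] relaxColor m s σ) :=
    relaxColor_spec (h.frame hs.toFrame rfl) (hs.index 5 (by decide))
  have relaxes (s : Memory) (σ : ℕ → Fin I.n) (hs : Visit [5] relaxColor m s σ)
      (hJ : Relaxes I (m.arr costArr) (s.arr costArr)) :
      Relaxes I (m.arr costArr) ((relaxColor.run s).arr costArr) := hJ.trans (step s σ hs).1
  have hrelax : Relaxes I (m.arr costArr) (((nest [5] relaxColor).run m).arr costArr) :=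
    nest_invariant (J := fun a => Relaxes I (m.arr costArr) (a costArr)) rfl h.nodes relaxes
      (.refl _)
  refine ⟨hrelax, fun r hr N u d hseq => ?_⟩
  cases hseq with
  | nil => exact hcost.of_relaxes hrelax 0 (Nat.zero_le k) 0 _ _ .nil
  | @step r N u₀ d₀ _ _ c hseq hc hu hd =>
    obtain ⟨z, hz, rfl⟩ := hc
    refine nest_hit (J := fun a => Relaxes I (m.arr costArr) (a costArr))
      (Q := fun a => a costArr u d ≤
        N + moveCost I.touch I.col I.start (I.col z) u₀ d₀) rfl h.nodes relaxes
      (fun s σ hs _ hQ => ((step s σ hs).1.le u d).trans hQ) (fun _ => z)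
      (fun s hs hJ => ?_) (.refl _)
    exact ((step s _ hs).2 hz u₀ d₀ u d hu hd).trans (Nat.add_le_add_right
      (hcost.of_relaxes hJ r (by omega) N u₀ d₀ hseq) _)

theorem computeCosts_spec (h : HoldsTouch I m) (hattained : Attained I (m.arr costArr))
    (hcost : BelowCosts I 0 (m.arr costArr)) :
    Attained I ((computeCosts.run m).arr costArr) ∧
      BelowCosts I I.n ((computeCosts.run m).arr costArr) := by
  rw [← h.nodes]
  refine loop_induction (x := 4) (p := nest [5] relaxColor)
    (J := fun k a => Attained I (a costArr) ∧ BelowCosts I k (a costArr))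
    ⟨hattained, hcost⟩ fun k _ s _ hs hJ => ?_
  have hrelax := nest_relaxColor_spec (h.frame hs rfl) hJ.2
  exact ⟨hrelax.1.attained hJ.1, hrelax.2⟩

end ShortestPath

/-! ### Correctness of the algorithm -/

section Solver

variable {I : Instance} {m : Memory}

theorem computeAnswer_spec (h : HoldsInput I m) (hzero : m.arr answerArr = 0) :
    (computeAnswer.run m).arr answerArr 0 0 ≠ 0 ↔
      ∃ u d : Fin I.n, ¬ relOf (m.arr avoidableArr) u d ∧
        m.arr costArr u d + m.arr countArr 0 0 ≤ I.bound := by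
  rw [computeAnswer, mark_spec (k := fun _ => 0) (l := fun _ => 0)
    (P := fun σ : ℕ → Fin I.n => ¬ relOf (m.arr avoidableArr) (σ 4) (σ 5) ∧
      m.arr costArr (σ 4) (σ 5) + m.arr countArr 0 0 ≤ I.bound) rfl h.nodes]
  · simp only [hzero, Pi.zero_apply, ne_eq, not_true_eq_false, false_or, and_true]
    exact ⟨fun ⟨σ, hσ⟩ => ⟨σ 4, σ 5, hσ⟩,
      fun ⟨u, d, hud⟩ => ⟨fun x => if x = 4 then u else d, by simpa using hud⟩⟩
  · intro s σ hs
    have h4 := hs.index 4 (by decide)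
    have h5 := hs.index 5 (by decide)
    have hcost : (Expr.add (.entry costArr 4 5) colorCount).eval s =
        m.arr costArr (σ 4) (σ 5) + m.arr countArr 0 0 := by
      rw [← hs.arr costArr (by decide), ← hs.arr countArr (by decide), Expr.eval,
        Expr.eval_entry h4 h5]
      rfl
    rw [Expr.holds_and, Expr.holds_not, Expr.holds_entry h4 h5, Expr.holds_le, hcost,
      hs.arr avoidableArr (by decide)]
    exact ⟨by rw [Expr.eval, (h.frame hs.toFrame rfl).bound], rfl, rfl⟩

theorem exists_moveSeq_of_isYes (hI : IsCocomparability I.graph) (h : I.IsYes) :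
    ∃ r ≤ I.n, ∃ N u d, MoveSeq I.touch I.col I.start r N u d ∧ IsGoal I.touch u d ∧
      N + (colors I.col I.start).card ≤ I.bound := by
  obtain ⟨γ, hlength, hγ⟩ := h
  obtain ⟨lt, _, hlt⟩ := exists_strictOrder_incompRel_eq_touch hI I.col I.start
  rw [conquered_start_eq_territory, ← hlt] at hγ
  obtain ⟨r, N, u, d, hseq, hgoal, hr, hN⟩ :=
    exists_moveSeq_of_territory_eq_univ (hlt ▸ mergesColors_touch) hγ
  rw [hlt] at hseq hgoal
  exact ⟨r, by simpa using hr, N, u, d, hseq, hgoal, hlength ▸ hN⟩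

theorem isYes_of_moveSeq {r N : ℕ} {u d : Fin I.n}
    (hseq : MoveSeq I.touch I.col I.start r N u d) (hgoal : IsGoal I.touch u d)
    (hN : N + (colors I.col I.start).card ≤ I.bound) : I.IsYes := by
  obtain ⟨γ, hlength, hγ⟩ := hseq.exists_territory_eq_univ hgoal hN
  exact ⟨γ, hlength, (conquered_start_eq_territory ..).trans hγ⟩

theorem prepare_spec (I : Instance) : HoldsTouch I (prepare.run I.memory) ∧
    (prepare.run I.memory).arr countArr 0 0 = (colors I.col I.start).card ∧
    Attained I ((prepare.run I.memory).arr costArr) ∧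
    BelowCosts I 0 ((prepare.run I.memory).arr costArr) := by
  have hinput := holdsInput_memory I
  have hblocks : HoldsInput I (computeBlocks.run I.memory) := hinput.run rfl
  have htouch : HoldsTouch I (computeTouch.run (computeBlocks.run I.memory)) :=
    ⟨hblocks.run rfl, computeTouch_spec hblocks (computeBlocks_spec hinput)
      (run_arr (by decide) I.memory)⟩
  have hcount := countColors_spec htouch.toHoldsInput
    (run_arr (p := seq computeBlocks computeTouch) (by decide) I.memory)
    (run_arr (p := seq computeBlocks computeTouch) (by decide) I.memory)
  have hcolors := htouch.run (p := countColors) rfl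
  exact ⟨hcolors.run rfl, (congrFun₂ (run_arr (p := initCosts) (by decide) _) 0 0).trans hcount,
    initCosts_spec hcolors.toHoldsInput⟩

theorem solver_spec (hI : IsCocomparability I.graph) :
    answer.Holds (solver.run I.memory) ↔ I.IsYes := by
  set m := prepare.run I.memory
  obtain ⟨htouch, hcount, hcost⟩ := prepare_spec I
  obtain ⟨hattained, hbelow⟩ := computeCosts_spec htouch hcost.1 hcost.2
  have hcosts := htouch.run (p := computeCosts) rfl
  set m' := computeCosts.run m
  have hgoal (u d : Fin I.n) :
      ¬ relOf (((computeAvoidable (.lit 1)).run m').arr avoidableArr) u d ↔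
        IsGoal I.touch u d := by
    rw [computeAvoidable_spec hcosts (P := fun _ => True) fun _ _ _ _ => by
      simp [Expr.Holds, Expr.eval]]
    simp [IsGoal]
  have hanswer : ((computeAvoidable (.lit 1)).run m').arr answerArr = 0 := run_arr
    (p := seq prepare (seq computeCosts (computeAvoidable (.lit 1)))) (by decide) I.memory
  have hcount' : m'.arr countArr 0 0 = (colors I.col I.start).card :=
    (congrFun₂ (run_arr (p := computeCosts) (by decide) m) 0 0).trans hcount
  rw [answer, Expr.Holds, Expr.eval, Expr.eval, solver, run, run, run, computeAnswer_spec
    (hcosts.run (p := computeAvoidable (.lit 1)) rfl).toHoldsInput hanswer]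
  simp only [hgoal, run_arr (p := computeAvoidable (.lit 1)) (A := costArr) (by decide),
    run_arr (p := computeAvoidable (.lit 1)) (A := countArr) (by decide)]
  constructor
  · rintro ⟨u, d, hud, hle⟩
    obtain ⟨r, N, hseq, hN⟩ := hattained u d (by omega)
    exact isYes_of_moveSeq hseq hud (hcount' ▸ (Nat.add_le_add_right hN _).trans hle)
  · intro hyes
    obtain ⟨r, hr, N, u, d, hseq, hud, hN⟩ := exists_moveSeq_of_isYes hI hyes
    exact ⟨u, d, hud, hcount' ▸ (Nat.add_le_add_right (hbelow r hr N u d hseq) _).trans hN⟩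

end Solver

theorem Instance.n_le_size (I : Instance) : I.n ≤ I.size := by
  have := Nat.le_mul_self I.n
  unfold Instance.size
  omega

theorem monotone_polynomial_eval {R : Type*} [CommSemiring R] [PartialOrder R]
    [CanonicallyOrderedAdd R] (p : Polynomial R) : Monotone fun x => p.eval x := by
  intro x y hxy
  simp only [Polynomial.eval_eq_sum_range]
  gcongr

end HoneyBee

open HoneyBee in
theorem mainTheorem5_general :
    SolvableInPolyTimeOn fun I => IsCocomparability I.graph := by
  refine ⟨.seq solver.compile (.setVar 0 answer.bool),
    solver.stepBound + Polynomial.C (answer.bool.cost + 1), fun I hI => ?_⟩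
  obtain ⟨t, hexec, ht⟩ := LoopProg.exec_compile (p := solver) rfl I.memory
  refine ⟨_, _, .seq hexec (.setVar _ 0 answer.bool), ?_, ?_⟩
  · rw [Polynomial.eval_add, Polynomial.eval_C]
    exact Nat.add_le_add_right (ht.trans (monotone_polynomial_eval _ I.n_le_size)) _
  · simp only [Memory.setVar, ↓reduceIte, Expr.eval_bool]
    classical exact if_congr (solver_spec hI) rfl rfl

theorem mainTheorem5 :
    HoneyBee.SolvableInPolyTimeOn
      (fun I => I.graph.Connected ∧ HoneyBee.IsCocomparability I.graph) := by
  obtain ⟨prog, p, h⟩ := mainTheorem5_general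
  exact ⟨prog, p, fun I hI => h I hI.2⟩
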